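/- Let $n\ge 1$ and let $\omega_n=\mathcal H^{n-1}(\partial B_1)$ be the area of the unit sphere in $\mathbb R^n$. For $s\in(0,1)$, $E\subset\mathbb R^n$ measurable and $\Omega\subset\mathbb R^n$ open, put $$P_s(E,\Omega)=\mathcal L_s(E\cap\Omega,\mathbb R^n\setminus E)+\mathcal L_s(E\setminus\Omega,\Omega\setminus E),\qquad \mathcal L_s(A,B)=\int_A\int_B\frac{dx\,dy}{|x-y|^{n+s}}.$$ A measurable set $E$ is called $s$-minimal in $\Omega$ with exterior data $E_0$ if $E\setminus\Omega=E_0$, $P_s(E,\Omega)<\infty$, and $P_s(E,\Omega)\le P_s(F,\Omega)$ for every measurable $F$ with $F\setminus\Omega=E\setminus\Omega$. Such sets are always normalized in $\Omega$ by a modification on a null set: each $x\in\Omega$ with $|E\cap B_r(x)|=|B_r(x)|$ for some $r>0$ belongs to $E$, each $x\in\Omega$ with $|E\cap B_r(x)|=0$ for some $r>0$ does not belong to $E$, and $\partial E\cap\Omega=\{x\in\Omega: 0<|E\cap B_r(x)|<|B_r(x)|\text{ for all }r>0\}$. For $\delta>0$, the set $E$ is called $\delta$-dense in $\Omega$ if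 $|B_\delta(x)\cap E|>0$ for every $x\in\Omega$ with $B_\delta(x)\subset\subset\Omega$. **Theorem.** Let $\Omega\subset\mathbb R^n$ be a bounded and connected (non-empty) open set with $C^2$ boundary, and let $E_0\subset\mathbb R^n\setminus\Omega$ be a measurable set with $$\overline\alpha(E_0):=\limsup_{s\to0^+}\,s\int_{E_0\setminus B_1}\frac{dy}{|y|^{n+s}}<\frac{\omega_n}{2}.$$ Put $\beta=\frac{\omega_n-2\overline\alpha(E_0)}{4}$ and $\delta_s=\exp\left(-\frac1s\log\frac{\omega_n+2\beta}{\omega_n+\beta}\right)$. Then the following two results hold. (A) For every $s_0\in(0,\frac12]$ there exists $s_1=s_1(s_0,E_0,\Omega)\in(0,s_0]$ such that, if $0<s<s_1$ and $E$ is $s$-minimal in $\Omega$ with exterior data $E_0$, then either $E\cap\Omega=\emptyset$ or $E$ is $\delta_s$-dense in $\Omega$. (B) Either (B.1) there exists $\tilde s=\tilde s(E_0,\Omega)\in(0,1)$ such that $E\cap\Omega=\emptyset$ whenever $s\in(0,\tilde s)$ and $E$ is $s$-minimal in $\Omega$ with exterior data $E_0$, or (B.2) there exist sequences $\delta_k\searrow0$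 and $s_k\searrow0$ of positive numbers, with $s_k<1$, and sets $E_k$ such that each $E_k$ is $s_k$-minimal in $\Omega$ with exterior data $E_0$ and, for every $k$, $\partial E_k\cap B_{\delta_k}(x)\ne\emptyset$ for every ball $B_{\delta_k}(x)\subset\subset\Omega$. -/

import Mathlib

open MeasureTheory Metric Set Filter Topology
open scoped ENNReal

noncomputable section

/-- `ℝⁿ` with its Euclidean norm and Lebesgue measure. -/
abbrev Rn (n : ℕ) : Type := EuclideanSpace ℝ (Fin n)

/-- The area `ω_n` of the unit sphere of `ℝⁿ`, through `|B_1| = ω_n / n`. -/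
def sphereArea (n : ℕ) : ℝ :=
  (n : ℝ) * (volume (ball (0 : Rn n) 1)).toReal

/-- The interaction `L_s(A, B) = ∫_A ∫_B |x - y|^{-(n+s)} dy dx`, with values in `[0, ∞]`. -/
def interaction (n : ℕ) (s : ℝ) (A B : Set (Rn n)) : ℝ≥0∞ :=
  ∫⁻ x in A, ∫⁻ y in B, ENNReal.ofReal (1 / ‖x - y‖ ^ ((n : ℝ) + s))

/-- The fractional perimeter `P_s(E, Ω) = L_s(E ∩ Ω, CE) + L_s(E \ Ω, Ω \ E)`. -/
def fracPerimeter (n : ℕ) (s : ℝ) (E Ω : Set (Rn n)) : ℝ≥0∞ :=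
  interaction n s (E ∩ Ω) Eᶜ + interaction n s (E \ Ω) (Ω \ E)

/-- `E` is normalized in `Ω`: in `Ω`, the set `E` contains its measure theoretic interior,
its complement contains the measure theoretic exterior, and the topological boundary of `E`
is the measure theoretic boundary. Every Lebesgue measurable set has such a representative
that differs from it by a null subset of `Ω` only. -/
structure IsNormalizedIn {n : ℕ} (E Ω : Set (Rn n)) : Prop where
  interior_subset : ∀ x ∈ Ω, (∃ r > 0, volume (E ∩ ball x r) = volume (ball x r)) → x ∈ E
  exterior_subset : ∀ x ∈ Ω, (∃ r > 0, volume (E ∩ ball x r) = 0) → x ∉ E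
  frontier_eq : ∀ x ∈ Ω, (x ∈ frontier E ↔
    ∀ r > 0, 0 < volume (E ∩ ball x r) ∧ volume (E ∩ ball x r) < volume (ball x r))

/-- `E` is a (Lebesgue measurable) `s`-minimal set in `Ω` with exterior data `E₀`, normalized
in `Ω`. `NullMeasurableSet` is measurability for the completion, i.e. Lebesgue measurability. -/
structure IsSMinimal {n : ℕ} (s : ℝ) (Ω E₀ E : Set (Rn n)) : Prop where
  measurable : NullMeasurableSet E volume
  exterior_data : E \ Ω = E₀
  normalized : IsNormalizedIn E Ω
  finite : fracPerimeter n s E Ω ≠ ⊤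
  minimal : ∀ F : Set (Rn n), NullMeasurableSet F volume → F \ Ω = E \ Ω →
    fracPerimeter n s E Ω ≤ fracPerimeter n s F Ω

/-- The upper contribution from infinity,
`limsup_{s → 0⁺} s ∫_{E \ B_1} |y|^{-(n+s)} dy`. For `s > 0` the integrand is integrable on
`E \ B_1` and the expression lies in `[0, ω_n]`, so that the real `limsup` is the true one. -/
def alphaSup {n : ℕ} (E : Set (Rn n)) : ℝ :=
  limsup (fun s : ℝ => s * ∫ y in E \ ball (0 : Rn n) 1, 1 / ‖y‖ ^ ((n : ℝ) + s)) (𝓝[>] 0)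

/-- `β(E₀) = (ω_n - 2 ᾱ(E₀)) / 4`. -/
def betaOf {n : ℕ} (E₀ : Set (Rn n)) : ℝ :=
  (sphereArea n - 2 * alphaSup E₀) / 4

/-- `δ_s(E₀) = exp (-(1/s) log ((ω_n + 2β) / (ω_n + β)))`. -/
def deltaOf {n : ℕ} (E₀ : Set (Rn n)) (s : ℝ) : ℝ :=
  Real.exp (-(1 / s) *
    Real.log ((sphereArea n + 2 * betaOf E₀) / (sphereArea n + betaOf E₀)))

/-- `E` is `δ`-dense in `Ω`: `|B_δ(x) ∩ E| > 0` for all `x ∈ Ω` with `B_δ(x) ⊂⊂ Ω`. -/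
def IsDeltaDense {n : ℕ} (δ : ℝ) (E Ω : Set (Rn n)) : Prop :=
  ∀ x ∈ Ω, closedBall x δ ⊆ Ω → 0 < volume (ball x δ ∩ E)

/-- `Ω` has `C²` boundary: near each boundary point, `Ω` is the region below the graph of a `C²`
function over the hyperplane orthogonal to some unit vector `ν` (the orthogonal projection of
`y` to that hyperplane is `y - ⟪ν, y⟫ ν`). -/
def HasC2Boundary {n : ℕ} (Ω : Set (Rn n)) : Prop :=
  ∀ x ∈ frontier Ω, ∃ (r : ℝ) (ν : Rn n) (g : Rn n → ℝ),
    0 < r ∧ ‖ν‖ = 1 ∧ ContDiff ℝ 2 g ∧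
      ∀ y ∈ ball x r, (y ∈ Ω ↔ inner ℝ ν y < g (y - inner ℝ ν y • ν))

end

/-!
No regularity theory of nonlocal minimal surfaces is needed: the Euler–Lagrange inequality is
replaced by a calibration with concentric balls.

Let `E` be `s`-minimal in `Ω`, let `B = ball x₀ ρ ⊆ Ω` and `A = E ∩ B`. Comparing `E` with `E \ B`
gives `L_s(A, Eᶜ) ≤ L_s(A, E \ A)` (`IsSMinimal.interaction_le`). On the other hand, for each
`x ∈ A` compare the kernel on `{y | ‖y - x₀‖ < ‖x - x₀‖}` with the kernel on `{y | ‖x - x₀‖ < ‖y - x₀‖}`. On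
pairs of points of `A` both contributions have the same integral, by symmetry of the kernel, so that
a pointwise curvature inequality for the spheres around `x₀` yields
`L_s(A, E \ A) + |A| ≤ L_s(A, Eᶜ)` (`calibration`), hence `|A| = 0`.

The curvature inequality is only needed at points `x ∈ A`. If `E` is null in `ball x₀ δ_s`, these
satisfy `‖x - x₀‖ ≥ δ_s`. Near `x` the curvature of the sphere is then bounded by a reflection
(`lintegral_outside_near_le`); on the annulus between the radii `δ_s` and `R` the loss is
`ω_n (δ_s^{-s} - R^{-s}) / s`, about `ω_n β / ((ω_n + β) s)`; and the gain from infinity is at least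
about `2 β / s`, because `alphaSup E₀ < ω_n / 2 - β`. So for small `s` a ball of radius `δ_s` in
which `E` is null can be enlarged as long as it stays in `Ω` (`eventually_null_ball_enlarges`).

It follows that nullity of `E` propagates along paths of centres of balls of radius `δ_s` in `Ω`. As
`Ω` has `C²` boundary, the set of these centres is path connected
(`exists_joinedIn_innerParallelSet`) and the balls cover `Ω` (`exists_innerParallelSet_cover`); thus
either `E` is `δ_s`-dense or `E ∩ Ω` is empty, by normalization.

For the second part, if the sets do not eventually vanish in `Ω`, there are minimal sets with
arbitrarily small `s` that are dense at any given scale. They do not contain a ball of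
fixed radius up to a null set, because removing it would change the energy by at most `-2 β |B| / s`
plus `o(1 / s)` (`eventually_ball_not_ae_subset`). So every ball of that radius in `Ω` meets both
the set and its complement, hence the boundary.
-/

/-! ### The kernel and its integrals -/

/-- The kernel `|z|^{-(n+s)}` of the fractional perimeter, with values in `[0, ∞]`; it is `0` at
the origin, where `1 / 0 = 0`. -/
noncomputable def rieszKernel (n : ℕ) (s : ℝ) (z : Rn n) : ℝ≥0∞ :=
  ENNReal.ofReal (1 / ‖z‖ ^ ((n : ℝ) + s))

theorem measurable_rieszKernel (n : ℕ) (s : ℝ) : Measurable (rieszKernel n s) := by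
  unfold rieszKernel
  fun_prop

theorem rieszKernel_neg {n : ℕ} (s : ℝ) (z : Rn n) : rieszKernel n s (-z) = rieszKernel n s z := by
  simp [rieszKernel]

theorem interaction_eq {n : ℕ} (s : ℝ) (A B : Set (Rn n)) :
    interaction n s A B = ∫⁻ x in A, ∫⁻ y in B, rieszKernel n s (x - y) := rfl

theorem sphereArea_pos {n : ℕ} (hn : 1 ≤ n) : 0 < sphereArea n := by
  have : 0 < (volume (ball (0 : Rn n) 1)).toReal :=
    ENNReal.toReal_pos (measure_ball_pos _ _ one_pos).ne' measure_ball_lt_top.ne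
  have hn' : (0 : ℝ) < n := by exact_mod_cast hn
  exact mul_pos hn' this

theorem rieszKernel_le {n : ℕ} {s r : ℝ} (hs : 0 < s) (hr : 0 < r) {z : Rn n} (hz : r ≤ ‖z‖) :
    rieszKernel n s z ≤ ENNReal.ofReal (r ^ (-((n : ℝ) + s))) := by
  apply ENNReal.ofReal_le_ofReal
  rw [Real.rpow_neg hr.le, one_div]
  gcongr

/-- Polar coordinates: the integral of the kernel outside a centred ball. -/
theorem lintegral_rieszKernel_compl_ball_zero {n : ℕ} (hn : 1 ≤ n) {s R : ℝ} (hs : 0 < s)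
    (hR : 0 < R) :
    ∫⁻ z in (ball (0 : Rn n) R)ᶜ, rieszKernel n s z =
      ENNReal.ofReal (sphereArea n * R ^ (-s) / s) := by
  have : Nonempty (Fin n) := ⟨⟨0, hn⟩⟩
  set f : ℝ → ℝ := (Ici R).indicator fun t => 1 / t ^ ((n : ℝ) + s) with hf
  have hpow : ∀ y ∈ Ioi (0 : ℝ), y ^ (n - 1) • f y =
      (Ici R).indicator (fun t : ℝ => t ^ (-1 - s)) y := by
    intro y hy
    have hy' : (0 : ℝ) < y := hy
    simp only [hf, indicator, mem_Ici, smul_eq_mul]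
    split_ifs with h
    · rw [← Real.rpow_natCast, one_div, ← Real.rpow_neg hy'.le, ← Real.rpow_add hy']
      congr 1
      rw [Nat.cast_sub hn]
      push_cast
      ring
    · simp
  have hfin : Module.finrank ℝ (Rn n) = n := by simp
  have hint1 : IntegrableOn (fun y : ℝ => y ^ (n - 1) • f y) (Ioi 0) := by
    rw [integrableOn_congr_fun hpow measurableSet_Ioi]
    have : IntegrableOn (fun t : ℝ => t ^ (-1 - s)) (Ici R) :=
      (integrableOn_Ici_iff_integrableOn_Ioi).2
        (integrableOn_Ioi_rpow_of_lt (by linarith) hR)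
    exact (this.integrable_indicator measurableSet_Ici).integrableOn
  have hint : Integrable (fun z : Rn n => f ‖z‖) volume := by
    rw [integrable_fun_norm_addHaar volume (f := f), hfin]
    exact hint1
  have hval : ∫ z : Rn n, f ‖z‖ = sphereArea n * R ^ (-s) / s := by
    rw [integral_fun_norm_addHaar volume f, hfin, setIntegral_congr_fun measurableSet_Ioi hpow,
      setIntegral_indicator measurableSet_Ici]
    have : Ioi (0 : ℝ) ∩ Ici R = Ici R := by
      ext t
      simp only [mem_inter_iff, mem_Ioi, mem_Ici, and_iff_right_iff_imp]
      intro h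
      linarith
    rw [this, integral_Ici_eq_integral_Ioi, integral_Ioi_rpow_of_lt (by linarith) hR]
    simp only [sphereArea, Measure.real, nsmul_eq_mul, smul_eq_mul]
    have e : -1 - s + 1 = -s := by ring
    rw [e, neg_div_neg_eq]
    ring
  have hnn : ∀ z : Rn n, 0 ≤ f ‖z‖ := by
    intro z
    simp only [hf, indicator]
    split_ifs <;> positivity
  rw [← hval, ofReal_integral_eq_lintegral_ofReal hint (ae_of_all _ hnn),
    ← lintegral_indicator measurableSet_ball.compl]
  congr 1
  ext z
  simp only [indicator, hf, rieszKernel, mem_compl_iff, mem_ball, dist_zero_right, not_lt, mem_Ici]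
  split_ifs <;> simp

/-- Translation and reflection of the variable of integration. -/
theorem setLIntegral_comp_sub_left {n : ℕ} (k : Rn n → ℝ≥0∞) (x : Rn n) {S : Set (Rn n)}
    (hS : MeasurableSet S) :
    ∫⁻ y in S, k (x - y) = ∫⁻ z in (fun z => x - z) ⁻¹' S, k z := by
  have hS' : MeasurableSet ((fun z => x - z) ⁻¹' S) := by
    apply hS.preimage
    fun_prop
  rw [← lintegral_indicator hS, ← lintegral_indicator hS',
    ← lintegral_sub_left_eq_self (fun z => ((fun z => x - z) ⁻¹' S).indicator k z) x]
  congr 1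
  ext y
  have : (x - y ∈ (fun z => x - z) ⁻¹' S) ↔ y ∈ S := by simp
  by_cases hy : y ∈ S
  · rw [indicator_of_mem hy, indicator_of_mem (this.2 hy)]
  · rw [indicator_of_notMem hy, indicator_of_notMem (mt this.1 hy)]

theorem lintegral_rieszKernel_compl_ball {n : ℕ} (hn : 1 ≤ n) {s R : ℝ} (hs : 0 < s)
    (hR : 0 < R) (x : Rn n) :
    ∫⁻ y in (ball x R)ᶜ, rieszKernel n s (x - y) =
      ENNReal.ofReal (sphereArea n * R ^ (-s) / s) := by
  rw [setLIntegral_comp_sub_left _ _ measurableSet_ball.compl,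
    ← lintegral_rieszKernel_compl_ball_zero hn hs hR]
  congr 2
  ext z
  simp [dist_eq_norm]

theorem lintegral_rieszKernel_annulus {n : ℕ} (hn : 1 ≤ n) {s r R : ℝ} (hs : 0 < s)
    (hr : 0 < r) (hrR : r ≤ R) (x : Rn n) :
    ∫⁻ y in ball x R \ ball x r, rieszKernel n s (x - y) =
      ENNReal.ofReal (sphereArea n * (r ^ (-s) - R ^ (-s)) / s) := by
  have hR : 0 < R := hr.trans_le hrR
  have h1 := lintegral_inter_add_sdiff (μ := volume.restrict (ball x r)ᶜ)
    (fun y => rieszKernel n s (x - y)) univ (measurableSet_ball (x := x) (ε := R))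
  have e1 : (univ ∩ ball x R) ∩ (ball x r)ᶜ = ball x R \ ball x r := by
    ext; simp
  have e2 : (univ \ ball x R) ∩ (ball x r)ᶜ = (ball x R)ᶜ := by
    rw [← compl_eq_univ_sdiff]
    exact inter_eq_left.2 (compl_subset_compl.2 (ball_subset_ball hrR))
  rw [Measure.restrict_restrict (by measurability), Measure.restrict_restrict (by measurability),
    e1, e2, Measure.restrict_univ, lintegral_rieszKernel_compl_ball hn hs hr,
    lintegral_rieszKernel_compl_ball hn hs hR] at h1
  have hω := sphereArea_pos hn
  have hle : R ^ (-s) ≤ r ^ (-s) := Real.rpow_le_rpow_of_nonpos hr hrR (by linarith)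
  have e3 : sphereArea n * r ^ (-s) / s =
      sphereArea n * (r ^ (-s) - R ^ (-s)) / s + sphereArea n * R ^ (-s) / s := by ring
  rw [e3, ENNReal.ofReal_add] at h1
  · exact (ENNReal.add_left_inj ENNReal.ofReal_ne_top).1 h1
  · have : 0 ≤ r ^ (-s) - R ^ (-s) := by linarith
    positivity
  · positivity

/-! ### Curvature of spheres -/

theorem volume_slab_le {n : ℕ} {e : Rn n} (he : ‖e‖ = 1) {t r : ℝ} (ht : 0 ≤ t) (hr : 0 ≤ r) :
    volume {z : Rn n | ‖z‖ ≤ r ∧ |inner ℝ e z| ≤ t} ≤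
      ENNReal.ofReal (2 * t * (2 * r) ^ (n - 1)) := by
  have hn : 0 < n := by
    rcases Nat.eq_zero_or_pos n with rfl | h
    · have : e = 0 := Subsingleton.elim _ _
      simp [this] at he
    · exact h
  let i₀ : Fin n := ⟨0, hn⟩
  have hv : Orthonormal ℝ (({i₀} : Set (Fin n)).domRestrict fun _ => e) := by
    rw [orthonormal_iff_ite]
    rintro ⟨i, hi⟩ ⟨j, hj⟩
    have hi' : i = i₀ := hi
    have hj' : j = i₀ := hj
    subst hi' hj'
    simp [he]
  obtain ⟨b, hb⟩ := hv.exists_orthonormalBasis_extension_of_card_eq (by simp)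
  have hb0 : b i₀ = e := hb i₀ rfl
  have hmp : MeasurePreserving (fun z : Rn n => WithLp.ofLp (b.repr z)) volume volume :=
    (PiLp.volume_preserving_ofLp (Fin n)).comp b.measurePreserving_repr
  let a : Fin n → ℝ := fun i => if i = i₀ then t else r
  have hsub : {z : Rn n | ‖z‖ ≤ r ∧ |inner ℝ e z| ≤ t} ⊆
      (fun z : Rn n => WithLp.ofLp (b.repr z)) ⁻¹' Icc (-a) a := by
    rintro z ⟨hz1, hz2⟩
    have key : ∀ i, |inner ℝ (b i) z| ≤ a i := by
      intro i
      simp only [a]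
      split_ifs with h
      · rw [h, hb0]; exact hz2
      · calc |inner ℝ (b i) z| ≤ ‖b i‖ * ‖z‖ := abs_real_inner_le_norm _ _
          _ ≤ r := by simpa using hz1
    constructor
    · intro i
      have := (abs_le.1 (key i)).1
      simpa [b.repr_apply_apply] using this
    · intro i
      have := (abs_le.1 (key i)).2
      simpa [b.repr_apply_apply] using this
  refine (measure_mono hsub).trans ?_
  rw [hmp.measure_preimage measurableSet_Icc.nullMeasurableSet, Real.volume_Icc_pi,
    ← ENNReal.ofReal_prod_of_nonneg]
  · apply ENNReal.ofReal_le_ofReal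
    rw [← Finset.mul_prod_erase _ _ (Finset.mem_univ i₀)]
    have : ∏ i ∈ Finset.univ.erase i₀, (a i - (-a) i) = (2 * r) ^ (n - 1) := by
      rw [Finset.prod_congr rfl (g := fun _ => 2 * r)]
      · simp
      · intro i hi
        have : i ≠ i₀ := Finset.ne_of_mem_erase hi
        simp only [a, Pi.neg_apply, this, if_false]
        ring
    rw [this]
    have : a i₀ - (-a) i₀ = 2 * t := by
      simp only [a, Pi.neg_apply, if_true]
      ring
    rw [this]
  · intro i _
    simp only [a, Pi.neg_apply]
    split_ifs <;> linarith

/-- The constant of the curvature bound `lintegral_wedge_le`: the sum of a geometric series over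
the dyadic annuli. -/
noncomputable def wedgeConst (n : ℕ) : ℝ := 4 ^ n * (1 - (2 : ℝ) ^ (-(1 / 2) : ℝ))⁻¹

theorem two_rpow_neg_half_lt_one : (2 : ℝ) ^ (-(1 / 2) : ℝ) < 1 :=
  Real.rpow_lt_one_of_one_lt_of_neg (by norm_num) (by norm_num)

theorem wedgeConst_pos (n : ℕ) : 0 < wedgeConst n := by
  have := two_rpow_neg_half_lt_one
  have : 0 < 1 - (2 : ℝ) ^ (-(1 / 2) : ℝ) := by linarith
  unfold wedgeConst
  positivity

/-- The set between two balls of radius `‖p‖` tangent to each other from outside is thin near the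
point of contact, so that the kernel is integrable there, uniformly in `s ≤ 1 / 2`. On the dyadic
annulus `‖z‖ ∼ r` this set lies in a slab of width `r ^ 2 / δ`. -/
theorem lintegral_wedge_le {n : ℕ} {s δ : ℝ} (hs : 0 < s) (hs' : s ≤ 1 / 2) (hδ : 0 < δ)
    {p : Rn n} (hp : δ ≤ ‖p‖) :
    ∫⁻ z in {z : Rn n | 0 < ‖z‖ ∧ ‖z‖ < δ ∧ 2 * |inner ℝ p z| ≤ ‖z‖ ^ 2}, rieszKernel n s z ≤
      ENNReal.ofReal (wedgeConst n * δ ^ (-s)) := by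
  have hp0 : 0 < ‖p‖ := hδ.trans_le hp
  set e : Rn n := ‖p‖⁻¹ • p with he
  have he1 : ‖e‖ = 1 := by
    rw [he, norm_smul, norm_inv, norm_norm, inv_mul_cancel₀ hp0.ne']
  have hn : 1 ≤ n := by
    rcases Nat.eq_zero_or_pos n with rfl | h
    · have : e = 0 := Subsingleton.elim _ _
      simp [this] at he1
    · exact h
  set r : ℕ → ℝ := fun k => δ / 2 ^ k with hr
  have hrpos : ∀ k, 0 < r k := fun k => by positivity
  set T : ℕ → Set (Rn n) := fun k =>
    {z | ‖z‖ ≤ r k ∧ |inner ℝ e z| ≤ r k ^ 2 / (2 * δ)} ∩ {z | r k / 2 ≤ ‖z‖} with hT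
  have hcov : {z : Rn n | 0 < ‖z‖ ∧ ‖z‖ < δ ∧ 2 * |inner ℝ p z| ≤ ‖z‖ ^ 2} ⊆ ⋃ k, T k := by
    rintro z ⟨hz0, hz1, hz2⟩
    obtain ⟨k, hk1, hk2⟩ := exists_nat_pow_near (x := δ / ‖z‖) (y := 2)
      ((one_le_div hz0).2 hz1.le) (by norm_num)
    rw [le_div_iff₀ hz0] at hk1
    rw [div_lt_iff₀ hz0, pow_succ] at hk2
    have h2k : (0 : ℝ) < 2 ^ k := by positivity
    have hzr : ‖z‖ ≤ r k := by
      rw [hr, le_div_iff₀ h2k]; linarith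
    refine mem_iUnion.2 ⟨k, ⟨hzr, ?_⟩, ?_⟩
    · have h1 : |inner ℝ e z| = |inner ℝ p z| / ‖p‖ := by
        rw [he, real_inner_smul_left, abs_mul, abs_inv, abs_norm, inv_mul_eq_div]
      rw [h1, div_le_div_iff₀ hp0 (by positivity)]
      have h3 : ‖z‖ ^ 2 ≤ r k ^ 2 := by gcongr
      have h4 : 0 ≤ r k ^ 2 := by positivity
      calc |inner ℝ p z| * (2 * δ) = (2 * |inner ℝ p z|) * δ := by ring
        _ ≤ r k ^ 2 * ‖p‖ := by gcongr; linarith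
    · simp only [mem_ofPred_eq, hr]
      rw [div_div, div_le_iff₀ (by positivity)]
      linarith
  -- volume `∼ r ^ n 2 ^ (-k)` against the kernel `∼ r ^ (-n - s)`: this is where `s ≤ 1 / 2` enters
  set q : ℝ := (2 : ℝ) ^ (-(1 / 2) : ℝ) with hq
  have hq0 : 0 ≤ q := by positivity
  have hq1 : q < 1 := two_rpow_neg_half_lt_one
  have hterm : ∀ k, ∫⁻ z in T k, rieszKernel n s z ≤
      ENNReal.ofReal (4 ^ n * δ ^ (-s) * q ^ k) := by
    intro k
    have hk := hrpos k
    have hbound : ∀ z ∈ T k, rieszKernel n s z ≤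
        ENNReal.ofReal ((r k / 2) ^ (-((n : ℝ) + s))) :=
      fun z hz => rieszKernel_le hs (by positivity) hz.2
    calc ∫⁻ z in T k, rieszKernel n s z
        ≤ ∫⁻ z in T k, ENNReal.ofReal ((r k / 2) ^ (-((n : ℝ) + s))) := by
          refine setLIntegral_mono measurable_const hbound
      _ = ENNReal.ofReal ((r k / 2) ^ (-((n : ℝ) + s))) * volume (T k) := by simp
      _ ≤ ENNReal.ofReal ((r k / 2) ^ (-((n : ℝ) + s))) *
          ENNReal.ofReal (2 * (r k ^ 2 / (2 * δ)) * (2 * r k) ^ (n - 1)) := by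
          gcongr
          exact (measure_mono inter_subset_left).trans
            (volume_slab_le he1 (by positivity) hk.le)
      _ = ENNReal.ofReal ((r k / 2) ^ (-((n : ℝ) + s)) *
          (2 * (r k ^ 2 / (2 * δ)) * (2 * r k) ^ (n - 1))) := by
          rw [← ENNReal.ofReal_mul (by positivity)]
      _ ≤ _ := by
          apply ENNReal.ofReal_le_ofReal
          have e1 : (r k / 2) ^ (-((n : ℝ) + s)) =
              2 ^ s * 2 ^ n * ((r k) ^ n)⁻¹ * (r k) ^ (-s) := by
            rw [Real.div_rpow hk.le (by norm_num), neg_add, Real.rpow_add hk,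
              Real.rpow_add (by norm_num : (0:ℝ) < 2), Real.rpow_neg hk.le,
              Real.rpow_natCast, Real.rpow_neg (by norm_num : (0:ℝ) ≤ 2),
              Real.rpow_natCast, Real.rpow_neg (by norm_num : (0:ℝ) ≤ 2)]
            field_simp
          have e2 : 2 * (r k ^ 2 / (2 * δ)) * (2 * r k) ^ (n - 1) =
              2 ^ (n - 1) * (r k) ^ n * (2 ^ k)⁻¹ := by
            obtain ⟨m, rfl⟩ : ∃ m, n = m + 1 := ⟨n - 1, by omega⟩
            simp only [add_tsub_cancel_right]
            have : r k / δ = (2 ^ k)⁻¹ := by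
              simp only [hr]; field_simp
            rw [← this, mul_pow]
            field_simp
            ring
          have e3 : (r k) ^ (-s) = δ ^ (-s) * ((2 : ℝ) ^ s) ^ k := by
            simp only [hr]
            rw [Real.div_rpow hδ.le (by positivity), Real.rpow_neg (by positivity : (0:ℝ) ≤ 2 ^ k),
              div_inv_eq_mul, ← Real.rpow_natCast, ← Real.rpow_natCast, ← Real.rpow_mul (by norm_num),
              ← Real.rpow_mul (by norm_num), mul_comm s]
          have e4 : ((2 : ℝ) ^ s) ^ k * (2 ^ k)⁻¹ ≤ q ^ k := by
            rw [← inv_pow, ← mul_pow]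
            gcongr
            have : (2 : ℝ)⁻¹ = 2 ^ (-1 : ℝ) := by
              rw [Real.rpow_neg_one]
            rw [this, ← Real.rpow_add (by norm_num), hq]
            apply Real.rpow_le_rpow_of_exponent_le (by norm_num)
            linarith
          have e5 : (2 : ℝ) ^ s ≤ 2 := by
            calc (2 : ℝ) ^ s ≤ 2 ^ (1 : ℝ) :=
                Real.rpow_le_rpow_of_exponent_le (by norm_num) (by linarith)
              _ = 2 := by simp
          have e6 : (2 : ℝ) ^ (n - 1) * 2 = 2 ^ n := by
            rw [← pow_succ]; congr 1; omega
          have hrn : (r k ^ n)⁻¹ * r k ^ n = 1 := inv_mul_cancel₀ (by positivity)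
          rw [e1, e2, e3]
          calc 2 ^ s * 2 ^ n * (r k ^ n)⁻¹ * (δ ^ (-s) * (2 ^ s) ^ k) *
                (2 ^ (n - 1) * r k ^ n * (2 ^ k)⁻¹)
              = 2 ^ s * 2 ^ n * 2 ^ (n - 1) * δ ^ (-s) * ((2 ^ s) ^ k * (2 ^ k)⁻¹) *
                  ((r k ^ n)⁻¹ * r k ^ n) := by ring
            _ ≤ 2 * 2 ^ n * 2 ^ (n - 1) * δ ^ (-s) * q ^ k * 1 := by
                rw [hrn]; gcongr
            _ = 2 ^ n * (2 ^ (n - 1) * 2) * δ ^ (-s) * q ^ k := by ring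
            _ = 4 ^ n * δ ^ (-s) * q ^ k := by
                rw [e6, ← mul_pow]; norm_num
  calc _ ≤ ∫⁻ z in ⋃ k, T k, rieszKernel n s z := lintegral_mono_set hcov
    _ ≤ ∑' k, ∫⁻ z in T k, rieszKernel n s z := lintegral_iUnion_le _ _
    _ ≤ ∑' k, ENNReal.ofReal (4 ^ n * δ ^ (-s) * q ^ k) := ENNReal.tsum_le_tsum hterm
    _ = ENNReal.ofReal (∑' k, 4 ^ n * δ ^ (-s) * q ^ k) :=
        (ENNReal.ofReal_tsum_of_nonneg (fun k => by positivity)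
          ((summable_geometric_of_lt_one hq0 hq1).mul_left _)).symm
    _ = _ := by
        rw [tsum_mul_left, tsum_geometric_of_lt_one hq0 hq1, wedgeConst, ← hq]
        congr 1
        ring

/-- The kernel `|z|^{-(n+s)}` truncated at height `m`: bounded, and increasing to the kernel. -/
noncomputable def truncKernel (n : ℕ) (s : ℝ) (m : ℕ) (z : Rn n) : ℝ≥0∞ :=
  min (rieszKernel n s z) m

theorem measurable_truncKernel (n : ℕ) (s : ℝ) (m : ℕ) : Measurable (truncKernel n s m) :=
  (measurable_rieszKernel n s).min measurable_const

theorem truncKernel_neg {n : ℕ} (s : ℝ) (m : ℕ) (z : Rn n) :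
    truncKernel n s m (-z) = truncKernel n s m z := by
  simp [truncKernel, rieszKernel_neg]

theorem truncKernel_le {n : ℕ} (s : ℝ) (m : ℕ) (z : Rn n) :
    truncKernel n s m z ≤ rieszKernel n s z := min_le_left _ _

/-- Reflection at `x` maps the part of `{y | ‖x - x₀‖ < ‖y - x₀‖}` near `x` into the ball
`{y | ‖y - x₀‖ < ‖x - x₀‖}`, up to the thin set of `lintegral_wedge_le`. This replaces the bound
of the nonlocal mean curvature of a ball of radius at least `δ`. -/
theorem lintegral_outside_near_le {n : ℕ} {s δ : ℝ} (hs : 0 < s) (hs' : s ≤ 1 / 2) (hδ : 0 < δ)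
    (m : ℕ) {x x₀ : Rn n} (hx : δ ≤ ‖x - x₀‖) :
    ∫⁻ y in {y | ‖x - x₀‖ < ‖y - x₀‖} ∩ ball x δ, truncKernel n s m (x - y) ≤
      (∫⁻ y in {y | ‖y - x₀‖ < ‖x - x₀‖}, truncKernel n s m (x - y)) +
        ENNReal.ofReal (wedgeConst n * δ ^ (-s)) := by
  set p := x - x₀ with hp
  have hO : MeasurableSet {y : Rn n | ‖p‖ < ‖y - x₀‖} :=
    measurableSet_lt measurable_const (by fun_prop)
  have hB : MeasurableSet {y : Rn n | ‖y - x₀‖ < ‖p‖} :=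
    measurableSet_lt (by fun_prop) measurable_const
  rw [setLIntegral_comp_sub_left _ _ (hO.inter measurableSet_ball),
    setLIntegral_comp_sub_left (fun z => truncKernel n s m z) x hB]
  have hrefl : ∫⁻ z in (fun z => x - z) ⁻¹' {y | ‖y - x₀‖ < ‖p‖}, truncKernel n s m z =
      ∫⁻ z in {z | ‖p + z‖ < ‖p‖}, truncKernel n s m z := by
    have h := setLIntegral_comp_sub_left (fun z => truncKernel n s m z) (0 : Rn n)
      (S := (fun z => x - z) ⁻¹' {y | ‖y - x₀‖ < ‖p‖})
      (hB.preimage (by fun_prop))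
    simp only [zero_sub, truncKernel_neg] at h
    rw [h]
    congr 2
    ext z
    have : x - -z - x₀ = p + z := by rw [hp]; abel
    simp only [mem_preimage, mem_ofPred_eq, this]
  rw [hrefl]
  have hsub : (fun z => x - z) ⁻¹' ({y | ‖p‖ < ‖y - x₀‖} ∩ ball x δ) ⊆
      {z | ‖p + z‖ < ‖p‖} ∪
        {z : Rn n | 0 < ‖z‖ ∧ ‖z‖ < δ ∧ 2 * |inner ℝ p z| ≤ ‖z‖ ^ 2} := by
    rintro z ⟨hz1, hz2⟩
    have e1 : x - z - x₀ = p - z := by rw [hp]; abel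
    simp only [mem_ofPred_eq, e1] at hz1
    simp only [mem_ball, dist_eq_norm, sub_sub_cancel_left, norm_neg] at hz2
    by_cases h : ‖p + z‖ < ‖p‖
    · exact Or.inl h
    · push Not at h
      refine Or.inr ⟨?_, hz2, ?_⟩
      · rw [norm_pos_iff]
        rintro rfl
        simp at hz1
      · have h1 : ‖p‖ ^ 2 < ‖p - z‖ ^ 2 := by gcongr
        have h2 : ‖p‖ ^ 2 ≤ ‖p + z‖ ^ 2 := by gcongr
        rw [norm_sub_sq_real p z] at h1
        rw [norm_add_sq_real p z] at h2
        have : |2 * inner ℝ p z| ≤ ‖z‖ ^ 2 := abs_le.2 ⟨by linarith, by linarith⟩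
        rwa [abs_mul, abs_two] at this
  refine (lintegral_mono_set hsub).trans ((lintegral_union_le _ _ _).trans ?_)
  gcongr
  exact (lintegral_mono (truncKernel_le s m)).trans (lintegral_wedge_le hs hs' hδ hx)

/-! ### Calibration by concentric balls -/

theorem lintegral_lintegral_symm {n : ℕ} {k : Rn n → ℝ≥0∞} (hk : Measurable k)
    (hsymm : ∀ z, k (-z) = k z) (A B : Set (Rn n)) :
    ∫⁻ x in A, ∫⁻ y in B, k (x - y) = ∫⁻ x in B, ∫⁻ y in A, k (x - y) := by
  rw [lintegral_lintegral_swap (by fun_prop)]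
  refine lintegral_congr fun y => lintegral_congr fun x => ?_
  rw [← hsymm, neg_sub]

theorem interaction_comm {n : ℕ} (s : ℝ) (A B : Set (Rn n)) :
    interaction n s A B = interaction n s B A :=
  lintegral_lintegral_symm (measurable_rieszKernel n s) (rieszKernel_neg s) A B

theorem interaction_congr {n : ℕ} (s : ℝ) {A A' B B' : Set (Rn n)}
    (hA : A =ᵐ[volume] A') (hB : B =ᵐ[volume] B') :
    interaction n s A B = interaction n s A' B' := by
  simp only [interaction_eq, Measure.restrict_congr_set hA, Measure.restrict_congr_set hB]

/-- In the interaction of `A` with itself, the pairs `(x, y)` with `y` closer to `x₀` than `x`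
contribute as much as those with `y` farther away. -/
theorem lintegral_closer_eq_farther {n : ℕ} {k : Rn n → ℝ≥0∞} (hk : Measurable k)
    (hsymm : ∀ z, k (-z) = k z) (A : Set (Rn n)) (x₀ : Rn n) :
    ∫⁻ x in A, ∫⁻ y in A ∩ {y | ‖y - x₀‖ < ‖x - x₀‖}, k (x - y) =
      ∫⁻ x in A, ∫⁻ y in A ∩ {y | ‖x - x₀‖ < ‖y - x₀‖}, k (x - y) := by
  have hlt : MeasurableSet {q : Rn n × Rn n | ‖q.2 - x₀‖ < ‖q.1 - x₀‖} :=
    measurableSet_lt (by fun_prop) (by fun_prop)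
  have hm : Measurable ({q : Rn n × Rn n | ‖q.2 - x₀‖ < ‖q.1 - x₀‖}.indicator
      fun q => k (q.1 - q.2)) := Measurable.indicator (by fun_prop) hlt
  have e1 : ∀ x, ∫⁻ y in A ∩ {y | ‖y - x₀‖ < ‖x - x₀‖}, k (x - y) =
      ∫⁻ y in A, {q : Rn n × Rn n | ‖q.2 - x₀‖ < ‖q.1 - x₀‖}.indicator
        (fun q => k (q.1 - q.2)) (x, y) := by
    intro x
    have hS : MeasurableSet {y : Rn n | ‖y - x₀‖ < ‖x - x₀‖} :=
      measurableSet_lt (by fun_prop) measurable_const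
    rw [inter_comm, ← Measure.restrict_restrict hS, ← lintegral_indicator hS]
    rfl
  have e2 : ∀ x, ∫⁻ y in A ∩ {y | ‖x - x₀‖ < ‖y - x₀‖}, k (x - y) =
      ∫⁻ y in A, {q : Rn n × Rn n | ‖q.2 - x₀‖ < ‖q.1 - x₀‖}.indicator
        (fun q => k (q.1 - q.2)) (y, x) := by
    intro x
    have hS : MeasurableSet {y : Rn n | ‖x - x₀‖ < ‖y - x₀‖} :=
      measurableSet_lt measurable_const (by fun_prop)
    rw [inter_comm, ← Measure.restrict_restrict hS, ← lintegral_indicator hS]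
    refine lintegral_congr fun y => ?_
    simp only [indicator, mem_ofPred_eq]
    rw [← hsymm (x - y), neg_sub]
  simp only [e1, e2]
  exact lintegral_lintegral_swap hm.aemeasurable

/-- Calibration by the concentric balls around `x₀`, for a bounded kernel. Let `A` be the part of
`E` in the ball `B`. If at almost every `x ∈ A` the sphere around `x₀` through `x` satisfies a
strict curvature inequality, then `A` interacts less with `E \ A` than with the complement
of `E`: the interactions within `A` cancel by `lintegral_closer_eq_farther`. -/
theorem calibration_of_bounded {n : ℕ} {k : Rn n → ℝ≥0∞} (hk : Measurable k)
    (hsymm : ∀ z, k (-z) = k z) {m : ℝ≥0∞} (hm : m ≠ ⊤) (hkm : ∀ z, k z ≤ m)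
    {E : Set (Rn n)} (hE : MeasurableSet E) (x₀ : Rn n) (ρ : ℝ) {c : ℝ≥0∞}
    (h : ∀ᵐ x ∂volume.restrict (E ∩ ball x₀ ρ),
      (∫⁻ y in E ∩ {y | ‖x - x₀‖ < ‖y - x₀‖}, k (x - y)) + c ≤
        (∫⁻ y in {y | ‖y - x₀‖ < ‖x - x₀‖}, k (x - y)) +
          ∫⁻ y in Eᶜ \ ball x₀ ρ, k (x - y)) :
    (∫⁻ x in E ∩ ball x₀ ρ, ∫⁻ y in E \ ball x₀ ρ, k (x - y)) +
        c * volume (E ∩ ball x₀ ρ) ≤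
      ∫⁻ x in E ∩ ball x₀ ρ, ∫⁻ y in Eᶜ, k (x - y) := by
  set A := E ∩ ball x₀ ρ with hA
  have hAm : MeasurableSet A := hE.inter measurableSet_ball
  have hAfin : volume A ≠ ⊤ :=
    ((measure_mono inter_subset_right).trans_lt measure_ball_lt_top).ne
  -- the interaction of `A` with itself, which has to be finite in order to be cancelled
  set M := ∫⁻ x in A, ∫⁻ y in A ∩ {y | ‖y - x₀‖ < ‖x - x₀‖}, k (x - y) with hM
  have hMfin : M ≠ ⊤ := by
    have : M ≤ ∫⁻ x in A, ∫⁻ y in A, m :=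
      lintegral_mono fun x => (lintegral_mono_set inter_subset_left).trans
        (lintegral_mono fun y => hkm _)
    refine (this.trans_lt ?_).ne
    simp only [lintegral_const, Measure.restrict_apply MeasurableSet.univ, univ_inter]
    exact ENNReal.mul_lt_top (ENNReal.mul_lt_top hm.lt_top hAfin.lt_top) hAfin.lt_top
  have hpt : ∀ᵐ x ∂volume.restrict A,
      (∫⁻ y in A ∩ {y | ‖x - x₀‖ < ‖y - x₀‖}, k (x - y)) +
        ((∫⁻ y in E \ ball x₀ ρ, k (x - y)) + c) ≤
      (∫⁻ y in A ∩ {y | ‖y - x₀‖ < ‖x - x₀‖}, k (x - y)) + ∫⁻ y in Eᶜ, k (x - y) := by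
    filter_upwards [h, ae_restrict_mem hAm] with x hx hxA
    have hxb : ‖x - x₀‖ < ρ := by simpa [dist_eq_norm] using hxA.2
    have h1 : (∫⁻ y in A ∩ {y | ‖x - x₀‖ < ‖y - x₀‖}, k (x - y)) +
        (∫⁻ y in E \ ball x₀ ρ, k (x - y)) =
        ∫⁻ y in E ∩ {y | ‖x - x₀‖ < ‖y - x₀‖}, k (x - y) := by
      rw [← lintegral_inter_add_sdiff _ (E ∩ {y | ‖x - x₀‖ < ‖y - x₀‖})
        (measurableSet_ball (x := x₀) (ε := ρ))]
      congr 3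
      · rw [hA, inter_right_comm]
      · ext y
        simp only [Set.mem_sdiff, mem_ball, dist_eq_norm, not_lt, mem_inter_iff, mem_ofPred_eq]
        constructor
        · rintro ⟨h1, h2⟩
          exact ⟨⟨h1, hxb.trans_le h2⟩, h2⟩
        · rintro ⟨⟨h1, -⟩, h2⟩
          exact ⟨h1, h2⟩
    have h2 : (∫⁻ y in {y | ‖y - x₀‖ < ‖x - x₀‖}, k (x - y)) ≤
        (∫⁻ y in A ∩ {y | ‖y - x₀‖ < ‖x - x₀‖}, k (x - y)) +
          ∫⁻ y in Eᶜ ∩ ball x₀ ρ, k (x - y) := by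
      refine (lintegral_mono_set ?_).trans (lintegral_union_le _ _ _)
      intro y hy
      have hyb : y ∈ ball x₀ ρ := by
        rw [mem_ball, dist_eq_norm]
        exact lt_trans hy hxb
      by_cases hyE : y ∈ E
      · exact Or.inl ⟨⟨hyE, hyb⟩, hy⟩
      · exact Or.inr ⟨hyE, hyb⟩
    calc _ = (∫⁻ y in E ∩ {y | ‖x - x₀‖ < ‖y - x₀‖}, k (x - y)) + c := by
          rw [← add_assoc, h1]
      _ ≤ _ := hx
      _ ≤ (∫⁻ y in A ∩ {y | ‖y - x₀‖ < ‖x - x₀‖}, k (x - y)) +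
          (∫⁻ y in Eᶜ ∩ ball x₀ ρ, k (x - y)) + ∫⁻ y in Eᶜ \ ball x₀ ρ, k (x - y) := by
          gcongr
      _ = _ := by
          rw [add_assoc, lintegral_inter_add_sdiff _ _ measurableSet_ball]
  have hmeas : ∀ B : Set (Rn n), Measurable fun x => ∫⁻ y in B, k (x - y) := fun B =>
    Measurable.lintegral_prod_right' (f := fun q : Rn n × Rn n => k (q.1 - q.2)) (by fun_prop)
  have hint := lintegral_mono_ae hpt
  rw [lintegral_add_right _ ((hmeas _).add_const c),
    lintegral_add_right _ measurable_const, lintegral_add_right _ (hmeas _),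
    ← lintegral_closer_eq_farther hk hsymm A x₀, ← hM, setLIntegral_const] at hint
  exact (ENNReal.add_le_add_iff_left hMfin).1 hint

theorem iSup_truncKernel {n : ℕ} (s : ℝ) (z : Rn n) :
    ⨆ m, truncKernel n s m z = rieszKernel n s z := by
  simp only [truncKernel]
  rw [← inf_iSup_eq, ENNReal.iSup_natCast, inf_top_eq]

theorem interaction_eq_iSup {n : ℕ} (s : ℝ) (A B : Set (Rn n)) :
    interaction n s A B = ⨆ m, ∫⁻ x in A, ∫⁻ y in B, truncKernel n s m (x - y) := by
  have hmono : ∀ z : Rn n, Monotone fun m => truncKernel n s m z := fun z a b hab =>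
    min_le_min le_rfl (by exact_mod_cast hab)
  have hmeas : ∀ m, Measurable fun x => ∫⁻ y in B, truncKernel n s m (x - y) := fun m => by
    have := measurable_truncKernel n s m
    exact Measurable.lintegral_prod_right'
      (f := fun q : Rn n × Rn n => truncKernel n s m (q.1 - q.2)) (by fun_prop)
  rw [← lintegral_iSup hmeas fun a b hab x => lintegral_mono fun y => hmono _ hab, interaction_eq]
  refine lintegral_congr fun x => ?_
  rw [← lintegral_iSup]
  · simp only [iSup_truncKernel]
  · intro m
    have := measurable_truncKernel n s m
    fun_prop
  · exact fun a b hab y => hmono _ hab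

/-- Calibration by concentric balls for the kernel `|z|^{-(n+s)}`, through its truncations. -/
theorem calibration {n : ℕ} {s : ℝ} {E : Set (Rn n)} (hE : MeasurableSet E) (x₀ : Rn n) (ρ : ℝ)
    {c : ℝ≥0∞}
    (h : ∀ m : ℕ, 1 ≤ m → ∀ᵐ x ∂volume.restrict (E ∩ ball x₀ ρ),
      (∫⁻ y in E ∩ {y | ‖x - x₀‖ < ‖y - x₀‖}, truncKernel n s m (x - y)) + c ≤
        (∫⁻ y in {y | ‖y - x₀‖ < ‖x - x₀‖}, truncKernel n s m (x - y)) +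
          ∫⁻ y in Eᶜ \ ball x₀ ρ, truncKernel n s m (x - y)) :
    interaction n s (E ∩ ball x₀ ρ) (E \ ball x₀ ρ) + c * volume (E ∩ ball x₀ ρ) ≤
      interaction n s (E ∩ ball x₀ ρ) Eᶜ := by
  rw [interaction_eq_iSup s _ (E \ ball x₀ ρ), ENNReal.iSup_add]
  refine iSup_le fun m => ?_
  have hmono : truncKernel n s m ≤ truncKernel n s (max m 1) := fun z =>
    min_le_min le_rfl (by exact_mod_cast le_max_left m 1)
  calc _ ≤ (∫⁻ x in E ∩ ball x₀ ρ, ∫⁻ y in E \ ball x₀ ρ, truncKernel n s (max m 1) (x - y)) +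
        c * volume (E ∩ ball x₀ ρ) := by
        gcongr
        exact hmono _
    _ ≤ ∫⁻ x in E ∩ ball x₀ ρ, ∫⁻ y in Eᶜ, truncKernel n s (max m 1) (x - y) :=
        calibration_of_bounded (measurable_truncKernel n s _) (truncKernel_neg s _)
          (ENNReal.natCast_ne_top (max m 1)) (fun z => min_le_right _ _) hE x₀ ρ
          (h _ (le_max_right m 1))
    _ ≤ _ := lintegral_mono fun x => lintegral_mono fun y => truncKernel_le _ _ _

/-! ### The variational inequality of a minimal set -/

theorem interaction_union_le_left {n : ℕ} (s : ℝ) (A A' B : Set (Rn n)) :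
    interaction n s (A ∪ A') B ≤ interaction n s A B + interaction n s A' B :=
  lintegral_union_le _ _ _

theorem interaction_union_le_right {n : ℕ} (s : ℝ) (A B B' : Set (Rn n)) :
    interaction n s A (B ∪ B') ≤ interaction n s A B + interaction n s A B' := by
  rw [interaction_comm s A, interaction_comm s A, interaction_comm s A]
  exact interaction_union_le_left s B B' A

theorem interaction_inter_add_sdiff {n : ℕ} (s : ℝ) (A B : Set (Rn n)) {S : Set (Rn n)}
    (hS : MeasurableSet S) :
    interaction n s (A ∩ S) B + interaction n s (A \ S) B = interaction n s A B :=
  lintegral_inter_add_sdiff _ _ hS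

/-- The variational inequality obtained from removing the part of a minimal set in a ball. -/
theorem IsSMinimal.interaction_le {n : ℕ} {s : ℝ} {Ω E₀ E : Set (Rn n)}
    (hE : IsSMinimal s Ω E₀ E) (hΩ : MeasurableSet Ω) {x₀ : Rn n} {ρ : ℝ} (hB : ball x₀ ρ ⊆ Ω) :
    interaction n s (E ∩ ball x₀ ρ) Eᶜ ≠ ⊤ ∧
    interaction n s (E ∩ ball x₀ ρ) Eᶜ ≤ interaction n s (E ∩ ball x₀ ρ) (E \ ball x₀ ρ) := by
  set A := E ∩ ball x₀ ρ with hA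
  have hsplit := interaction_inter_add_sdiff s (E ∩ Ω) Eᶜ (measurableSet_ball (x := x₀) (ε := ρ))
  have hA' : E ∩ Ω ∩ ball x₀ ρ = A := by
    rw [inter_assoc, inter_eq_right.2 hB]
  rw [hA'] at hsplit
  set D := (E ∩ Ω) \ ball x₀ ρ with hD
  have hfin := hE.finite
  have hmin := hE.minimal (E \ ball x₀ ρ)
    (hE.measurable.diff measurableSet_ball.nullMeasurableSet) (by
      rw [Set.sdiff_sdiff, union_eq_right.2 hB])
  unfold fracPerimeter at hfin hmin
  rw [← hsplit] at hfin hmin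
  have f1 : interaction n s A Eᶜ ≠ ⊤ := fun h => hfin (by simp [h])
  have f2 : interaction n s D Eᶜ ≠ ⊤ := fun h => hfin (by simp [h])
  have f3 : interaction n s (E \ Ω) (Ω \ E) ≠ ⊤ := fun h => hfin (by simp [h])
  refine ⟨f1, ?_⟩
  have s1 : (E \ ball x₀ ρ) ∩ Ω = D := by
    ext y; simp only [hD, mem_inter_iff, Set.mem_sdiff]; tauto
  have s2 : (E \ ball x₀ ρ)ᶜ = Eᶜ ∪ A := by
    ext y; simp only [hA, mem_compl_iff, mem_union, mem_inter_iff, Set.mem_sdiff]; tauto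
  have s3 : (E \ ball x₀ ρ) \ Ω = E \ Ω := by
    rw [Set.sdiff_sdiff, union_eq_right.2 hB]
  have s4 : Ω \ (E \ ball x₀ ρ) = (Ω \ E) ∪ A := by
    ext y
    have := @hB y
    simp only [hA, mem_union, mem_inter_iff, Set.mem_sdiff]; tauto
  rw [s1, s2, s3, s4] at hmin
  have h1 := hmin.trans (add_le_add (interaction_union_le_right s D Eᶜ A)
    (interaction_union_le_right s (E \ Ω) (Ω \ E) A))
  -- `D` and `E \ Ω` make up `E \ ball x₀ ρ`; its interaction with `A` is the price of removing `A`
  have h2 : interaction n s D A + interaction n s (E \ Ω) A =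
      interaction n s A (E \ ball x₀ ρ) := by
    rw [interaction_comm s A, ← interaction_inter_add_sdiff s (E \ ball x₀ ρ) A hΩ, s1, s3]
  have h3 : interaction n s D Eᶜ + interaction n s (E \ Ω) (Ω \ E) +
      interaction n s A Eᶜ ≤ interaction n s D Eᶜ + interaction n s (E \ Ω) (Ω \ E) +
      interaction n s A (E \ ball x₀ ρ) := by
    rw [← h2]
    calc _ = _ := by ring
      _ ≤ _ := h1
      _ = _ := by ring
  exact (ENNReal.add_le_add_iff_left (ENNReal.add_ne_top.2 ⟨f2, f3⟩)).1 h3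

/-! ### Contributions from infinity and the curvature inequality -/

theorem lintegral_far_ne_top {n : ℕ} (hn : 1 ≤ n) {s : ℝ} (hs : 0 < s) (E : Set (Rn n)) :
    ∫⁻ y in E \ ball (0 : Rn n) 1, rieszKernel n s y ≠ ⊤ := by
  refine ((lintegral_mono_set (sdiff_subset_compl _ _)).trans_lt ?_).ne
  rw [lintegral_rieszKernel_compl_ball_zero hn hs one_pos]
  exact ENNReal.ofReal_lt_top

theorem integral_far_eq {n : ℕ} (s : ℝ) (E : Set (Rn n)) :
    ∫ y in E \ ball (0 : Rn n) 1, 1 / ‖y‖ ^ ((n : ℝ) + s) =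
      (∫⁻ y in E \ ball (0 : Rn n) 1, rieszKernel n s y).toReal :=
  integral_eq_lintegral_of_nonneg_ae (ae_of_all _ fun y => by positivity)
    (Measurable.aestronglyMeasurable (by fun_prop))

theorem isBoundedUnder_far {n : ℕ} (hn : 1 ≤ n) (E : Set (Rn n)) :
    IsBoundedUnder (· ≤ ·) (𝓝[>] 0)
      (fun s : ℝ => s * ∫ y in E \ ball (0 : Rn n) 1, 1 / ‖y‖ ^ ((n : ℝ) + s)) := by
  refine ⟨sphereArea n, eventually_map.2 ?_⟩
  filter_upwards [self_mem_nhdsWithin] with s hs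
  have hs' : (0 : ℝ) < s := hs
  have h : ∫⁻ y in E \ ball (0 : Rn n) 1, rieszKernel n s y ≤
      ENNReal.ofReal (sphereArea n * 1 ^ (-s) / s) := by
    rw [← lintegral_rieszKernel_compl_ball_zero hn hs' one_pos]
    exact lintegral_mono_set (sdiff_subset_compl _ _)
  have h2 := ENNReal.toReal_le_of_le_ofReal
    (by have := sphereArea_pos hn; positivity) h
  rw [integral_far_eq]
  rw [Real.one_rpow, mul_one, le_div_iff₀ hs'] at h2
  linarith

theorem alphaSup_nonneg {n : ℕ} (hn : 1 ≤ n) (E : Set (Rn n)) : 0 ≤ alphaSup E := by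
  refine le_limsup_of_frequently_le ?_ (isBoundedUnder_far hn E)
  refine Eventually.frequently ?_
  filter_upwards [self_mem_nhdsWithin] with s hs
  have hs' : (0 : ℝ) < s := hs
  rw [integral_far_eq]
  positivity

/-- The contribution of the exterior data outside a large ball `ball x R` is asymptotically at
most `alphaSup E₀ / s`, uniformly for `x` in a bounded set. -/
theorem exists_lintegral_far_le {n : ℕ} (hn : 1 ≤ n) (E₀ : Set (Rn n)) {R₀ a : ℝ} (hR₀ : 0 < R₀)
    (ha : alphaSup E₀ < a) :
    ∃ R : ℝ, 1 ≤ R ∧ 2 * R₀ ≤ R ∧ ∀ᶠ s : ℝ in 𝓝[>] 0, ∀ x ∈ ball (0 : Rn n) R₀,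
      ∫⁻ y in E₀ \ ball x R, rieszKernel n s (x - y) ≤ ENNReal.ofReal (a / s) := by
  obtain ⟨a', ha1, ha2⟩ := exists_between ha
  have ha0 : 0 ≤ a' := (alphaSup_nonneg hn E₀).trans ha1.le
  have hlim : Tendsto (fun R : ℝ => (1 + R₀ / R) ^ (n + 1) * a') atTop (𝓝 a') := by
    have h1 : Tendsto (fun R : ℝ => R₀ / R) atTop (𝓝 0) := tendsto_const_nhds.div_atTop tendsto_id
    have h2 := ((h1.const_add 1).pow (n + 1)).mul_const a'
    simpa using h2
  obtain ⟨R, hR, hRlarge⟩ := ((hlim.eventually_lt_const ha2).and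
    (eventually_ge_atTop (2 * R₀ + 1))).exists
  have hR0 : 0 < R := by linarith
  refine ⟨R, by linarith, by linarith, ?_⟩
  have hev := eventually_lt_of_limsup_lt ha1 (isBoundedUnder_far hn E₀)
  have hs1 : ∀ᶠ s : ℝ in 𝓝[>] 0, s < 1 :=
    mem_nhdsWithin_of_mem_nhds (Iio_mem_nhds one_pos)
  filter_upwards [hev, hs1, self_mem_nhdsWithin] with s hs hs1 hs0 x hx
  have hs0' : (0 : ℝ) < s := hs0
  set c : ℝ := (1 + R₀ / R) ^ (n + 1) with hc
  have hc0 : 0 ≤ c := by positivity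
  have hxn : ‖x‖ < R₀ := by simpa using hx
  have hpt : ∀ y ∈ E₀ \ ball x R, rieszKernel n s (x - y) ≤
      ENNReal.ofReal c * rieszKernel n s y := by
    intro y hy
    have hy2 : R ≤ ‖x - y‖ := by
      have := hy.2
      rwa [mem_ball, not_lt, dist_comm, dist_eq_norm] at this
    have htri : ‖y‖ ≤ ‖x - y‖ + ‖x‖ := by
      have := norm_sub_le x (x - y)
      rw [sub_sub_cancel] at this
      linarith
    have htri' : ‖x - y‖ ≤ ‖x‖ + ‖y‖ := norm_sub_le x y
    have hy0 : 0 < ‖y‖ := by linarith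
    have hxy0 : 0 < ‖x - y‖ := by linarith
    have hle : ‖y‖ ≤ (1 + R₀ / R) * ‖x - y‖ := by
      have : R₀ ≤ R₀ / R * ‖x - y‖ := by
        rw [div_mul_eq_mul_div, le_div_iff₀ hR0]
        gcongr
      linarith
    unfold rieszKernel
    rw [← ENNReal.ofReal_mul hc0]
    apply ENNReal.ofReal_le_ofReal
    have h1 : ‖y‖ ^ ((n : ℝ) + s) ≤ c * ‖x - y‖ ^ ((n : ℝ) + s) := by
      calc ‖y‖ ^ ((n : ℝ) + s) ≤ ((1 + R₀ / R) * ‖x - y‖) ^ ((n : ℝ) + s) := by gcongr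
        _ = (1 + R₀ / R) ^ ((n : ℝ) + s) * ‖x - y‖ ^ ((n : ℝ) + s) :=
            Real.mul_rpow (by positivity) hxy0.le
        _ ≤ c * ‖x - y‖ ^ ((n : ℝ) + s) := by
            gcongr
            rw [hc, ← Real.rpow_natCast]
            apply Real.rpow_le_rpow_of_exponent_le
            · have : 0 ≤ R₀ / R := by positivity
              linarith
            · push_cast
              linarith
    rw [mul_one_div, div_le_div_iff₀ (by positivity) (by positivity)]
    linarith
  have hsub : E₀ \ ball x R ⊆ E₀ \ ball (0 : Rn n) 1 := by
    refine sdiff_subset_sdiff_right (ball_subset_ball' ?_)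
    rw [dist_comm, dist_zero_right]
    linarith
  have hm : Measurable fun y : Rn n => ENNReal.ofReal c * rieszKernel n s y :=
    (measurable_rieszKernel n s).const_mul _
  calc ∫⁻ y in E₀ \ ball x R, rieszKernel n s (x - y)
      ≤ ∫⁻ y in E₀ \ ball x R, ENNReal.ofReal c * rieszKernel n s y :=
        setLIntegral_mono hm hpt
    _ ≤ ∫⁻ y in E₀ \ ball (0 : Rn n) 1, ENNReal.ofReal c * rieszKernel n s y :=
        lintegral_mono_set hsub
    _ = ENNReal.ofReal c * ∫⁻ y in E₀ \ ball (0 : Rn n) 1, rieszKernel n s y :=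
        lintegral_const_mul _ (measurable_rieszKernel n s)
    _ = ENNReal.ofReal (c * ∫ y in E₀ \ ball (0 : Rn n) 1, 1 / ‖y‖ ^ ((n : ℝ) + s)) := by
        rw [integral_far_eq, ENNReal.ofReal_mul hc0,
          ENNReal.ofReal_toReal (lintegral_far_ne_top hn hs0' E₀)]
    _ ≤ ENNReal.ofReal (a / s) := by
        apply ENNReal.ofReal_le_ofReal
        rw [le_div_iff₀ hs0']
        calc _ = c * (s * ∫ y in E₀ \ ball (0 : Rn n) 1, 1 / ‖y‖ ^ ((n : ℝ) + s)) := by ring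
          _ ≤ c * a' := by gcongr
          _ ≤ a := hR.le

/-- The choice of `δ_s` makes `δ_s ^ (-s)` constant and slightly larger than `1`. -/
theorem deltaOf_rpow_neg {n : ℕ} (hn : 1 ≤ n) {E₀ : Set (Rn n)} (hβ : 0 < betaOf E₀) {s : ℝ}
    (hs : 0 < s) :
    deltaOf E₀ s ^ (-s) = (sphereArea n + 2 * betaOf E₀) / (sphereArea n + betaOf E₀) := by
  have hω := sphereArea_pos hn
  rw [deltaOf, ← Real.exp_mul]
  have : -(1 / s) * Real.log ((sphereArea n + 2 * betaOf E₀) / (sphereArea n + betaOf E₀)) * -s =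
      Real.log ((sphereArea n + 2 * betaOf E₀) / (sphereArea n + betaOf E₀)) := by
    field_simp
  rw [this, Real.exp_log (by positivity)]

theorem deltaOf_pos {n : ℕ} (E₀ : Set (Rn n)) (s : ℝ) : 0 < deltaOf E₀ s := Real.exp_pos _

theorem tendsto_deltaOf {n : ℕ} (hn : 1 ≤ n) {E₀ : Set (Rn n)} (hβ : 0 < betaOf E₀) :
    Tendsto (deltaOf E₀) (𝓝[>] 0) (𝓝 0) := by
  have hω := sphereArea_pos hn
  have hlog : 0 < Real.log ((sphereArea n + 2 * betaOf E₀) / (sphereArea n + betaOf E₀)) := by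
    apply Real.log_pos
    rw [lt_div_iff₀ (by positivity)]
    linarith
  unfold deltaOf
  refine Real.tendsto_exp_atBot.comp ?_
  simp only [one_div]
  have h1 : Tendsto (fun s : ℝ => -s⁻¹) (𝓝[>] 0) atBot :=
    tendsto_neg_atTop_atBot.comp tendsto_inv_nhdsGT_zero
  exact h1.atBot_mul_const hlog

theorem alphaSup_lt_of_betaOf_pos {n : ℕ} {E₀ : Set (Rn n)} (hβ : 0 < betaOf E₀) :
    alphaSup E₀ < sphereArea n / 2 - betaOf E₀ := by
  unfold betaOf at *
  linarith

theorem truncKernel_eq {n : ℕ} {s R : ℝ} (hs : 0 < s) (hR : 1 ≤ R) {m : ℕ} (hm : 1 ≤ m)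
    {x y : Rn n} (hy : y ∉ ball x R) : truncKernel n s m (x - y) = rieszKernel n s (x - y) := by
  refine min_eq_left ?_
  have hy2 : 1 ≤ ‖x - y‖ := by
    rw [mem_ball, not_lt, dist_comm, dist_eq_norm] at hy
    exact hR.trans hy
  have h := rieszKernel_le (n := n) hs one_pos hy2
  rw [Real.one_rpow, ENNReal.ofReal_one] at h
  exact h.trans (by exact_mod_cast hm)

/-- The curvature inequality required by `calibration`: near `x` it is
`lintegral_outside_near_le`, on the annulus between the radii `δ` and `R` the worst case is assumed,
and outside `ball x R` the set `E` is controlled by the mass `a` of its exterior data. -/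
theorem curvature_inequality {n : ℕ} (hn : 1 ≤ n) {s δ R a : ℝ} (hs : 0 < s) (hs' : s ≤ 1 / 2)
    (hδ : 0 < δ) (hδR : δ ≤ R) (hR : 1 ≤ R) (ha : 0 ≤ a) {E : Set (Rn n)} {x x₀ : Rn n} {ρ : ℝ}
    (hρ : ball x₀ ρ ⊆ ball x R) (hx : δ ≤ ‖x - x₀‖)
    (hfar : ∫⁻ y in E \ ball x R, rieszKernel n s (x - y) ≤ ENNReal.ofReal a)
    (hnum : wedgeConst n * δ ^ (-s) + sphereArea n * (δ ^ (-s) - R ^ (-s)) / s + 2 * a + 1 ≤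
      sphereArea n * R ^ (-s) / s) {m : ℕ} (hm : 1 ≤ m) :
    (∫⁻ y in E ∩ {y | ‖x - x₀‖ < ‖y - x₀‖}, truncKernel n s m (x - y)) + 1 ≤
      (∫⁻ y in {y | ‖y - x₀‖ < ‖x - x₀‖}, truncKernel n s m (x - y)) +
        ∫⁻ y in Eᶜ \ ball x₀ ρ, truncKernel n s m (x - y) := by
  have hω := sphereArea_pos hn
  have hC := wedgeConst_pos n
  have hpow : R ^ (-s) ≤ δ ^ (-s) := Real.rpow_le_rpow_of_nonpos hδ hδR (by linarith)
  set T := sphereArea n * R ^ (-s) / s with hT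
  set D := sphereArea n * (δ ^ (-s) - R ^ (-s)) / s with hD
  set C := wedgeConst n * δ ^ (-s) with hCd
  have hD0 : 0 ≤ D := by
    have : 0 ≤ δ ^ (-s) - R ^ (-s) := by linarith
    positivity
  have hC0 : 0 ≤ C := by positivity
  set I := ∫⁻ y in {y | ‖y - x₀‖ < ‖x - x₀‖}, truncKernel n s m (x - y) with hI
  set J := ∫⁻ y in Eᶜ \ ball x₀ ρ, truncKernel n s m (x - y) with hJ
  have hfar' : ∫⁻ y in E \ ball x R, truncKernel n s m (x - y) ≤ ENNReal.ofReal a :=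
    (lintegral_mono fun y => truncKernel_le _ _ _).trans hfar
  have h1 : ∫⁻ y in E ∩ {y | ‖x - x₀‖ < ‖y - x₀‖}, truncKernel n s m (x - y) ≤
      (I + ENNReal.ofReal C) + ENNReal.ofReal D + ENNReal.ofReal a := by
    have hsub : E ∩ {y | ‖x - x₀‖ < ‖y - x₀‖} ⊆
        (({y | ‖x - x₀‖ < ‖y - x₀‖} ∩ ball x δ) ∪ (ball x R \ ball x δ)) ∪ (E \ ball x R) := by
      rintro y ⟨hy1, hy2⟩
      by_cases h1 : y ∈ ball x R
      · by_cases h2 : y ∈ ball x δ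
        · exact Or.inl (Or.inl ⟨hy2, h2⟩)
        · exact Or.inl (Or.inr ⟨h1, h2⟩)
      · exact Or.inr ⟨hy1, h1⟩
    refine (lintegral_mono_set hsub).trans ((lintegral_union_le _ _ _).trans ?_)
    refine add_le_add ((lintegral_union_le _ _ _).trans (add_le_add ?_ ?_)) hfar'
    · exact lintegral_outside_near_le hs hs' hδ m hx
    · rw [hD, ← lintegral_rieszKernel_annulus hn hs hδ hδR x]
      exact lintegral_mono fun y => truncKernel_le _ _ _
  have h2 : ENNReal.ofReal T ≤ ENNReal.ofReal a + J := by
    rw [hT, ← lintegral_rieszKernel_compl_ball hn hs (by linarith) x]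
    have : ∫⁻ y in (ball x R)ᶜ, rieszKernel n s (x - y) =
        ∫⁻ y in (ball x R)ᶜ, truncKernel n s m (x - y) :=
      setLIntegral_congr_fun measurableSet_ball.compl fun y hy => (truncKernel_eq hs hR hm hy).symm
    rw [this]
    have hsub : (ball x R)ᶜ ⊆ (E \ ball x R) ∪ (Eᶜ \ ball x₀ ρ) := by
      intro y hy
      by_cases h : y ∈ E
      · exact Or.inl ⟨h, hy⟩
      · exact Or.inr ⟨h, fun h' => hy (hρ h')⟩
    refine (lintegral_mono_set hsub).trans ((lintegral_union_le _ _ _).trans ?_)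
    gcongr
  have h3 : ENNReal.ofReal (C + D + a + 1) ≤ J := by
    have : ENNReal.ofReal a + ENNReal.ofReal (C + D + a + 1) ≤ ENNReal.ofReal a + J := by
      rw [← ENNReal.ofReal_add ha (by positivity)]
      exact (ENNReal.ofReal_le_ofReal (by linarith)).trans h2
    exact (ENNReal.add_le_add_iff_left ENNReal.ofReal_ne_top).1 this
  calc _ ≤ (I + ENNReal.ofReal C) + ENNReal.ofReal D + ENNReal.ofReal a + 1 := by gcongr
    _ = I + ENNReal.ofReal (C + D + a + 1) := by
        rw [ENNReal.ofReal_add (by positivity) zero_le_one, ENNReal.ofReal_add (by positivity) ha,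
          ENNReal.ofReal_add hC0 hD0, ENNReal.ofReal_one]
        ring
    _ ≤ I + J := by gcongr

/-! ### Minimal sets for small `s` -/

theorem tendsto_const_rpow_neg {R : ℝ} (hR : 0 < R) :
    Tendsto (fun s : ℝ => R ^ (-s)) (𝓝[>] 0) (𝓝 1) := by
  have h : Continuous fun s : ℝ => R ^ (-s) :=
    Real.continuous_const_rpow hR.ne' |>.comp continuous_neg
  have := h.tendsto 0
  rw [neg_zero, Real.rpow_zero] at this
  exact this.mono_left nhdsWithin_le_nhds

/-- The balance of the contributions to the curvature for `δ = δ_s` and small `s`. -/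
theorem eventually_curvature_balance {n : ℕ} (hn : 1 ≤ n) {E₀ : Set (Rn n)} (hβ : 0 < betaOf E₀)
    {R : ℝ} (hR : 0 < R) :
    ∀ᶠ s : ℝ in 𝓝[>] 0, wedgeConst n * deltaOf E₀ s ^ (-s) +
        sphereArea n * (deltaOf E₀ s ^ (-s) - R ^ (-s)) / s +
        2 * ((sphereArea n / 2 - betaOf E₀) / s) + 1 ≤ sphereArea n * R ^ (-s) / s := by
  have hω := sphereArea_pos hn
  set q := (sphereArea n + 2 * betaOf E₀) / (sphereArea n + betaOf E₀) with hq
  have hωq : sphereArea n * q < sphereArea n + betaOf E₀ := by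
    rw [hq, ← mul_div_assoc, div_lt_iff₀ (by positivity)]
    nlinarith
  have hid : Tendsto (fun s : ℝ => s) (𝓝[>] 0) (𝓝 0) := tendsto_id.mono_left nhdsWithin_le_nhds
  have hlim : Tendsto (fun s : ℝ => s * (wedgeConst n * q + 1) - 2 * sphereArea n * R ^ (-s))
      (𝓝[>] 0) (𝓝 (0 * (wedgeConst n * q + 1) - 2 * sphereArea n * 1)) :=
    (hid.mul_const _).sub ((tendsto_const_rpow_neg hR).const_mul _)
  have hlt : 0 * (wedgeConst n * q + 1) - 2 * sphereArea n * 1 <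
      -(sphereArea n * q + sphereArea n - 2 * betaOf E₀) := by linarith
  filter_upwards [hlim.eventually_lt_const hlt, self_mem_nhdsWithin] with s hs hs0
  have hs0' : (0 : ℝ) < s := hs0
  rw [deltaOf_rpow_neg hn hβ hs0', ← hq, le_div_iff₀ hs0']
  have e : (wedgeConst n * q + sphereArea n * (q - R ^ (-s)) / s +
      2 * ((sphereArea n / 2 - betaOf E₀) / s) + 1) * s =
      s * (wedgeConst n * q + 1) + sphereArea n * (q - R ^ (-s)) +
        2 * (sphereArea n / 2 - betaOf E₀) := by
    field_simp
    ring
  rw [e]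
  linarith

theorem IsSMinimal.sdiff_ball_subset {n : ℕ} {s : ℝ} {Ω E₀ E : Set (Rn n)}
    (hE : IsSMinimal s Ω E₀ E) {x : Rn n} {R : ℝ} (hΩ : Ω ⊆ ball x R) :
    E \ ball x R ⊆ E₀ \ ball x R := by
  rintro y ⟨hy1, hy2⟩
  refine ⟨?_, hy2⟩
  rw [← hE.exterior_data]
  exact ⟨hy1, fun h => hy2 (hΩ h)⟩

/-- The scale `R`, beyond which only the exterior data matter, and the resulting bound. -/
theorem exists_scale {n : ℕ} (hn : 1 ≤ n) {Ω E₀ : Set (Rn n)} (hΩ : Bornology.IsBounded Ω)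
    (hβ : 0 < betaOf E₀) :
    ∃ R : ℝ, 1 ≤ R ∧ (∀ x ∈ Ω, Ω ⊆ ball x R) ∧ ∀ᶠ s : ℝ in 𝓝[>] 0, ∀ x ∈ Ω,
      ∀ E, IsSMinimal s Ω E₀ E → ∫⁻ y in E \ ball x R, rieszKernel n s (x - y) ≤
        ENNReal.ofReal ((sphereArea n / 2 - betaOf E₀) / s) := by
  obtain ⟨R₀, hR₀, hsub⟩ := hΩ.subset_ball_lt 0 0
  obtain ⟨R, hR1, hR2, hfar⟩ := exists_lintegral_far_le hn E₀ hR₀ (alphaSup_lt_of_betaOf_pos hβ)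
  have hΩR : ∀ x ∈ Ω, Ω ⊆ ball x R := by
    intro x hx y hy
    have h1 : ‖x‖ < R₀ := by simpa using hsub hx
    have h2 : ‖y‖ < R₀ := by simpa using hsub hy
    rw [mem_ball, dist_eq_norm]
    linarith [norm_sub_le y x]
  refine ⟨R, hR1, hΩR, ?_⟩
  filter_upwards [hfar] with s hs x hx E hE
  exact (lintegral_mono_set (hE.sdiff_ball_subset (hΩR x hx))).trans (hs x (hsub hx))

theorem far_mass_nonneg {n : ℕ} (hn : 1 ≤ n) {E₀ : Set (Rn n)} (hβ : 0 < betaOf E₀) :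
    0 ≤ sphereArea n / 2 - betaOf E₀ :=
  (alphaSup_nonneg hn E₀).trans (alphaSup_lt_of_betaOf_pos hβ).le

/-- For small `s`, a ball of radius `δ_s` disjoint from a minimal set can be enlarged, with the
same centre, as long as it stays in `Ω`: otherwise the part of the set in the larger ball could be
removed with a gain of energy. -/
theorem eventually_null_ball_enlarges {n : ℕ} (hn : 1 ≤ n) {Ω E₀ : Set (Rn n)}
    (hΩo : MeasurableSet Ω) (hΩ : Bornology.IsBounded Ω) (hβ : 0 < betaOf E₀) :
    ∀ᶠ s : ℝ in 𝓝[>] 0, ∀ E, IsSMinimal s Ω E₀ E → ∀ (x₀ : Rn n) (ρ : ℝ), ball x₀ ρ ⊆ Ω →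
      volume (E ∩ ball x₀ (deltaOf E₀ s)) = 0 → volume (E ∩ ball x₀ ρ) = 0 := by
  obtain ⟨R, hR1, hΩR, hfar⟩ := exists_scale hn hΩ hβ
  have hδ1 := (tendsto_deltaOf hn hβ).eventually_lt_const one_pos
  have hs2 : ∀ᶠ s : ℝ in 𝓝[>] 0, s < 1 / 2 :=
    mem_nhdsWithin_of_mem_nhds (Iio_mem_nhds (by norm_num))
  filter_upwards [hfar, hδ1, hs2, eventually_curvature_balance hn hβ (R := R) (by linarith),
    self_mem_nhdsWithin] with s hfar hδ1 hs2 hnum hs0 E hE x₀ ρ hB hnull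
  have hs0' : (0 : ℝ) < s := hs0
  -- `E'` is a Borel representative; the interactions do not see the difference
  obtain ⟨E', -, hE'm, hE'⟩ := hE.measurable.exists_measurable_superset_ae_eq
  have hA : (E' ∩ ball x₀ ρ : Set (Rn n)) =ᵐ[volume] (E ∩ ball x₀ ρ : Set (Rn n)) :=
    hE'.inter (ae_eq_refl _)
  have hD : (E' \ ball x₀ ρ : Set (Rn n)) =ᵐ[volume] (E \ ball x₀ ρ : Set (Rn n)) :=
    hE'.diff (ae_eq_refl _)
  have hnull' : volume (E' ∩ ball x₀ (deltaOf E₀ s)) = 0 := by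
    rw [← hnull]
    exact measure_congr (hE'.inter (ae_eq_refl _))
  have hcal := calibration (s := s) hE'm x₀ ρ (c := 1) (by
    intro m hm
    filter_upwards [ae_restrict_of_ae (measure_eq_zero_iff_ae_notMem.1 hnull'),
      ae_restrict_mem (hE'm.inter measurableSet_ball)] with x hx1 hx2
    have hxΩ : x ∈ Ω := hB hx2.2
    refine curvature_inequality hn hs0' hs2.le (deltaOf_pos E₀ s) (hδ1.le.trans hR1) hR1
      (div_nonneg (far_mass_nonneg hn hβ) hs0'.le) (hB.trans (hΩR x hxΩ)) ?_ ?_ hnum hm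
    · by_contra hlt
      push Not at hlt
      exact hx1 ⟨hx2.1, by rwa [mem_ball, dist_eq_norm]⟩
    · have e : (E' \ ball x R : Set (Rn n)) =ᵐ[volume] (E \ ball x R : Set (Rn n)) :=
        hE'.diff (ae_eq_refl _)
      rw [Measure.restrict_congr_set e]
      exact hfar x hxΩ E hE)
  rw [interaction_congr s hA hD, interaction_congr s hA hE'.compl, one_mul,
    measure_congr hA] at hcal
  obtain ⟨hfin, hle⟩ := hE.interaction_le hΩo hB
  have h := hcal.trans hle
  by_contra hne
  have hD' : interaction n s (E ∩ ball x₀ ρ) (E \ ball x₀ ρ) ≠ ⊤ := by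
    refine ((le_self_add.trans hcal).trans_lt hfin.lt_top).ne
  exact absurd h (not_le.2 (ENNReal.lt_add_right hD' hne))

theorem lintegral_dist_sphere_ne_top {n : ℕ} (hn : 1 ≤ n) (c ρ : ℝ) :
    ∫⁻ x in ball (0 : Rn n) ρ, ENNReal.ofReal (c * (ρ - ‖x‖) ^ (-(1 / 2) : ℝ)) ≠ ⊤ := by
  have : Nonempty (Fin n) := ⟨⟨0, hn⟩⟩
  have h0 : IntegrableOn (fun y : ℝ => c * (ρ - y) ^ (-(1 / 2) : ℝ)) (Ioo 0 ρ) := by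
    rcases le_or_gt ρ 0 with h | h
    · rw [Ioo_eq_empty (by linarith)]
      exact integrableOn_empty
    have h1 : IntervalIntegrable (fun y : ℝ => y ^ (-(1 / 2) : ℝ)) volume 0 ρ :=
      intervalIntegral.intervalIntegrable_rpow' (by norm_num)
    have h2 := (h1.comp_sub_left ρ).const_mul c
    rw [sub_zero, sub_self] at h2
    exact ((intervalIntegrable_iff_integrableOn_Ioo_of_le h.le).1 h2.symm)
  have h1 : IntegrableOn (fun y : ℝ => y ^ (n - 1) • (c * (ρ - y) ^ (-(1 / 2) : ℝ))) (Ioo 0 ρ) := by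
    refine Integrable.bdd_mul (c := ρ ^ (n - 1)) h0
      (Measurable.aestronglyMeasurable (by fun_prop)) ?_
    filter_upwards [ae_restrict_mem measurableSet_Ioo] with y hy
    rw [norm_pow, Real.norm_of_nonneg hy.1.le]
    exact pow_le_pow_left₀ hy.1.le hy.2.le _
  have hfin : Module.finrank ℝ (Rn n) = n := by simp
  have h2 : IntegrableOn (fun x : Rn n => c * (ρ - ‖x‖) ^ (-(1 / 2) : ℝ)) (ball 0 ρ) := by
    rw [integrableOn_fun_norm_addHaar volume (f := fun y => c * (ρ - y) ^ (-(1 / 2) : ℝ)), hfin]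
    exact h1
  exact h2.lintegral_lt_top.ne

/-- The interaction of a point at depth `t` in a ball with the exterior of the ball, up to the
distance `R`, is of the integrable order `t ^ (-1/2)`, uniformly in `s ≤ 1 / 2`. -/
theorem lintegral_annulus_le {n : ℕ} (hn : 1 ≤ n) {s t R : ℝ} (hs' : s ≤ 1 / 2)
    (hs : 0 < s) (ht : 0 < t) (hR : 1 ≤ R) (x : Rn n) :
    ∫⁻ y in ball x R \ ball x t, rieszKernel n s (x - y) ≤
      ENNReal.ofReal (R ^ (1 / 2 : ℝ) * sphereArea n * 2 * t ^ (-(1 / 2) : ℝ)) := by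
  have hpt : ∀ y ∈ ball x R \ ball x t, rieszKernel n s (x - y) ≤
      ENNReal.ofReal (R ^ (1 / 2 : ℝ)) * rieszKernel n (1 / 2) (x - y) := by
    rintro y ⟨hy1, hy2⟩
    rw [mem_ball, dist_comm, dist_eq_norm] at hy1 hy2
    have hz : 0 < ‖x - y‖ := by linarith
    unfold rieszKernel
    rw [← ENNReal.ofReal_mul (by positivity)]
    apply ENNReal.ofReal_le_ofReal
    have h1 : ‖x - y‖ ^ ((n : ℝ) + 1 / 2) ≤ R ^ (1 / 2 : ℝ) * ‖x - y‖ ^ ((n : ℝ) + s) := by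
      have e : (n : ℝ) + 1 / 2 = (1 / 2 - s) + (n + s) := by ring
      rw [e, Real.rpow_add hz]
      gcongr
      calc ‖x - y‖ ^ (1 / 2 - s) ≤ R ^ (1 / 2 - s) := by
            apply Real.rpow_le_rpow hz.le hy1.le (by linarith)
        _ ≤ R ^ (1 / 2 : ℝ) := Real.rpow_le_rpow_of_exponent_le hR (by linarith)
    rw [mul_one_div, div_le_div_iff₀ (by positivity) (by positivity)]
    linarith
  have hm : Measurable fun y : Rn n => rieszKernel n (1 / 2) (x - y) := by
    have := measurable_rieszKernel n (1 / 2)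
    fun_prop
  calc _ ≤ ∫⁻ y in ball x R \ ball x t,
        ENNReal.ofReal (R ^ (1 / 2 : ℝ)) * rieszKernel n (1 / 2) (x - y) :=
        setLIntegral_mono (hm.const_mul _) hpt
    _ ≤ ∫⁻ y in (ball x t)ᶜ, ENNReal.ofReal (R ^ (1 / 2 : ℝ)) * rieszKernel n (1 / 2) (x - y) :=
        lintegral_mono_set (sdiff_subset_compl _ _)
    _ = _ := by
        rw [lintegral_const_mul _ hm, lintegral_rieszKernel_compl_ball hn (by norm_num) ht,
          ← ENNReal.ofReal_mul (by positivity)]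
        congr 1
        ring

/-- For small `s`, a minimal set does not contain a ball of fixed radius in `Ω`: removing the ball
would change the energy by a negative multiple of `1 / s`, up to bounded terms. -/
theorem eventually_ball_not_ae_subset {n : ℕ} (hn : 1 ≤ n) {Ω E₀ : Set (Rn n)}
    (hΩo : MeasurableSet Ω) (hΩ : Bornology.IsBounded Ω) (hβ : 0 < betaOf E₀) {ρ : ℝ}
    (hρ : 0 < ρ) :
    ∀ᶠ s : ℝ in 𝓝[>] 0, ∀ E, IsSMinimal s Ω E₀ E → ∀ x₀ : Rn n, ball x₀ ρ ⊆ Ω →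
      volume (ball x₀ ρ \ E) ≠ 0 := by
  have hω := sphereArea_pos hn
  obtain ⟨R, hR1, hΩR, hfar⟩ := exists_scale hn hΩ hβ
  have hs2 : ∀ᶠ s : ℝ in 𝓝[>] 0, s < 1 / 2 :=
    mem_nhdsWithin_of_mem_nhds (Iio_mem_nhds (by norm_num))
  -- a bound, independent of `s`, of the interaction of the ball with its exterior up to
  -- distance `R`
  set M := ∫⁻ x in ball (0 : Rn n) ρ,
    ENNReal.ofReal (R ^ (1 / 2 : ℝ) * sphereArea n * 2 * (ρ - ‖x‖) ^ (-(1 / 2) : ℝ)) with hM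
  have hMfin : M ≠ ⊤ := lintegral_dist_sphere_ne_top hn _ ρ
  set V := (volume (ball (0 : Rn n) ρ)).toReal with hV
  have hVpos : 0 < V :=
    ENNReal.toReal_pos (measure_ball_pos _ _ hρ).ne' measure_ball_lt_top.ne
  have hvol : ∀ x₀ : Rn n, volume (ball x₀ ρ) = ENNReal.ofReal V := fun x₀ => by
    rw [hV, ENNReal.ofReal_toReal measure_ball_lt_top.ne, Measure.addHaar_ball_center]
  have hid : Tendsto (fun s : ℝ => s) (𝓝[>] 0) (𝓝 0) := tendsto_id.mono_left nhdsWithin_le_nhds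
  have hlim : Tendsto (fun s : ℝ => s * M.toReal - sphereArea n * R ^ (-s) * V) (𝓝[>] 0)
      (𝓝 (0 * M.toReal - sphereArea n * 1 * V)) :=
    (hid.mul_const _).sub
      (((tendsto_const_rpow_neg (by linarith)).const_mul _).mul_const _)
  have hlt : 0 * M.toReal - sphereArea n * 1 * V <
      -(2 * (sphereArea n / 2 - betaOf E₀) * V) := by
    have := mul_pos hβ hVpos
    linarith
  filter_upwards [hfar, hs2, hlim.eventually_lt_const hlt, self_mem_nhdsWithin]
    with s hfar hs2 hnum hs0 E hE x₀ hB hnull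
  have hs0' : (0 : ℝ) < s := hs0
  set a := (sphereArea n / 2 - betaOf E₀) / s with ha
  have ha0 : 0 ≤ a := div_nonneg (far_mass_nonneg hn hβ) hs0'.le
  set T := sphereArea n * R ^ (-s) / s with hT
  have hA : (E ∩ ball x₀ ρ : Set (Rn n)) =ᵐ[volume] (ball x₀ ρ : Set (Rn n)) := by
    rw [inter_comm]
    exact ae_eq_set.2 ⟨by rw [sdiff_eq_empty.2 inter_subset_left, measure_empty],
      by rwa [sdiff_self_inter]⟩
  obtain ⟨-, hle⟩ := hE.interaction_le hΩo hB
  rw [interaction_congr s hA (B := Eᶜ) (B' := Eᶜ) (ae_eq_refl _),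
    interaction_congr s hA (B := E \ ball x₀ ρ) (B' := E \ ball x₀ ρ) (ae_eq_refl _)] at hle
  have hlow : ENNReal.ofReal ((T - a) * V) ≤ interaction n s (ball x₀ ρ) Eᶜ := by
    have hpt : ∀ x ∈ ball x₀ ρ, ENNReal.ofReal (T - a) ≤
        ∫⁻ y in Eᶜ, rieszKernel n s (x - y) := by
      intro x hx
      have h1 : ENNReal.ofReal T ≤
          ENNReal.ofReal a + ∫⁻ y in Eᶜ, rieszKernel n s (x - y) := by
        rw [hT, ← lintegral_rieszKernel_compl_ball hn hs0' (by linarith : 0 < R) x]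
        have hsub : (ball x R)ᶜ ⊆ (E \ ball x R) ∪ Eᶜ := by
          intro y hy
          by_cases h : y ∈ E
          · exact Or.inl ⟨h, hy⟩
          · exact Or.inr h
        refine (lintegral_mono_set hsub).trans ((lintegral_union_le _ _ _).trans ?_)
        gcongr
        exact hfar x (hB hx) E hE
      rw [ENNReal.ofReal_sub _ ha0]
      exact tsub_le_iff_left.2 h1
    calc ENNReal.ofReal ((T - a) * V) = ENNReal.ofReal (T - a) * volume (ball x₀ ρ) := by
          rw [hvol, ENNReal.ofReal_mul' hVpos.le]
      _ = ∫⁻ x in ball x₀ ρ, ENNReal.ofReal (T - a) := by rw [setLIntegral_const]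
      _ ≤ _ := setLIntegral_mono' measurableSet_ball hpt
  have hup : interaction n s (ball x₀ ρ) (E \ ball x₀ ρ) ≤ ENNReal.ofReal (a * V + M.toReal) := by
    have hpt : ∀ x ∈ ball x₀ ρ, ∫⁻ y in E \ ball x₀ ρ, rieszKernel n s (x - y) ≤
        ENNReal.ofReal a +
        ENNReal.ofReal (R ^ (1 / 2 : ℝ) * sphereArea n * 2 * (ρ - ‖x - x₀‖) ^ (-(1 / 2) : ℝ)) := by
      intro x hx
      have ht : 0 < ρ - ‖x - x₀‖ := by
        rw [mem_ball, dist_eq_norm] at hx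
        linarith
      have hsub : E \ ball x₀ ρ ⊆ (E \ ball x R) ∪ (ball x R \ ball x (ρ - ‖x - x₀‖)) := by
        rintro y ⟨hy1, hy2⟩
        by_cases h : y ∈ ball x R
        · refine Or.inr ⟨h, fun h' => hy2 (ball_subset_ball' ?_ h')⟩
          rw [dist_eq_norm]
          linarith
        · exact Or.inl ⟨hy1, h⟩
      refine (lintegral_mono_set hsub).trans ((lintegral_union_le _ _ _).trans ?_)
      exact add_le_add (hfar x (hB hx) E hE) (lintegral_annulus_le hn hs2.le hs0' ht hR1 x)
    have htrans : ∫⁻ x in ball x₀ ρ, ENNReal.ofReal (R ^ (1 / 2 : ℝ) * sphereArea n * 2 *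
        (ρ - ‖x - x₀‖) ^ (-(1 / 2) : ℝ)) = M := by
      rw [hM]
      have h := (measurePreserving_sub_right (volume : Measure (Rn n)) x₀).setLIntegral_comp_preimage
        (measurableSet_ball (x := (0 : Rn n)) (ε := ρ))
        (f := fun x => ENNReal.ofReal (R ^ (1 / 2 : ℝ) * sphereArea n * 2 *
          (ρ - ‖x‖) ^ (-(1 / 2) : ℝ))) (by fun_prop)
      rw [← h]
      congr 2
      ext x
      simp [dist_eq_norm]
    calc _ ≤ ∫⁻ x in ball x₀ ρ, (ENNReal.ofReal a +
        ENNReal.ofReal (R ^ (1 / 2 : ℝ) * sphereArea n * 2 *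
          (ρ - ‖x - x₀‖) ^ (-(1 / 2) : ℝ))) := setLIntegral_mono' measurableSet_ball hpt
      _ = ENNReal.ofReal a * volume (ball x₀ ρ) + M := by
          rw [lintegral_add_left measurable_const, htrans, setLIntegral_const]
      _ = _ := by
          rw [hvol, ← ENNReal.ofReal_mul ha0, ENNReal.ofReal_add (by positivity) (by positivity),
            ENNReal.ofReal_toReal hMfin]
  have hfinal := (ENNReal.ofReal_le_ofReal_iff (by positivity)).1 ((hlow.trans hle).trans hup)
  have e1 : s * T = sphereArea n * R ^ (-s) := by rw [hT]; field_simp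
  have e2 : s * a = sphereArea n / 2 - betaOf E₀ := by rw [ha]; field_simp
  have h3 : s * ((T - a) * V) ≤ s * (a * V + M.toReal) := by gcongr
  have h4 : s * ((T - a) * V) = (s * T) * V - (s * a) * V := by ring
  have h5 : s * (a * V + M.toReal) = (s * a) * V + s * M.toReal := by ring
  rw [h4, h5, e1, e2] at h3
  linarith

/-! ### Balls inside a `C²` domain -/

/-- The centres of the closed balls of radius `δ` contained in `Ω`. -/
def innerParallelSet {n : ℕ} (δ : ℝ) (Ω : Set (Rn n)) : Set (Rn n) := {x | closedBall x δ ⊆ Ω}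

/-- In a chart with defining function `F y = g (y - ⟪ν, y⟫ ν) - ⟪ν, y⟫`, the function `F` changes
at unit speed along `-ν`. -/
theorem chart_add_smul {n : ℕ} {ν : Rn n} (hν : ‖ν‖ = 1) (g : Rn n → ℝ) (y : Rn n) (t : ℝ) :
    g ((y + t • ν) - inner ℝ ν (y + t • ν) • ν) - inner ℝ ν (y + t • ν) =
      g (y - inner ℝ ν y • ν) - inner ℝ ν y - t := by
  have h : inner ℝ ν (y + t • ν) = inner ℝ ν y + t := by
    rw [inner_add_right, inner_smul_right, real_inner_self_eq_norm_sq, hν]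
    ring
  rw [h]
  have : y + t • ν - (inner ℝ ν y + t) • ν = y - inner ℝ ν y • ν := by
    rw [add_smul]; abel
  rw [this]
  ring

/-- A bound `F ≥ F y + ⟪G, · - y⟫ - K ‖· - y‖ ^ 2` with `‖G‖ ≥ 1` gives balls of any radius
`δ ≤ 1 / (2 K)` in `{F > 0}` that contain `y`: shift the centre from `y` in the direction of `G`,
by almost `δ`. -/
theorem exists_closedBall_pos {n : ℕ} {F : Rn n → ℝ} {y G : Rn n} {K δ : ℝ} (hy : 0 < F y)
    (hG : 1 ≤ ‖G‖) (hδ : 0 < δ) (hK : 0 ≤ K) (hKδ : 2 * K * δ ≤ 1)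
    (hF : ∀ z ∈ closedBall y (2 * δ), F y + inner ℝ G (z - y) - K * ‖z - y‖ ^ 2 ≤ F z) :
    ∃ x, y ∈ ball x δ ∧ closedBall x δ ⊆ closedBall y (2 * δ) ∧ ∀ z ∈ closedBall x δ, 0 < F z := by
  have hG0 : 0 < ‖G‖ := by linarith
  -- the centre is shifted by `δ - σ`, with `σ` small compared to `F y`
  set σ : ℝ := min (δ / 2) (F y / (4 * ‖G‖)) with hσ
  have hσ0 : 0 < σ := by positivity
  have hσ1 : σ ≤ δ / 2 := min_le_left _ _
  have hσ2 : ‖G‖ * σ ≤ F y / 4 := by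
    have : σ ≤ F y / (4 * ‖G‖) := min_le_right _ _
    rw [le_div_iff₀ (by positivity)] at this
    linarith
  set τ : ℝ := δ - σ with hτ
  have hτ0 : 0 < τ := by linarith
  set N : Rn n := ‖G‖⁻¹ • G with hN
  have hN1 : ‖N‖ = 1 := by
    rw [hN, norm_smul, norm_inv, norm_norm, inv_mul_cancel₀ hG0.ne']
  have hGN : G = ‖G‖ • N := by
    rw [hN, smul_smul, mul_inv_cancel₀ hG0.ne', one_smul]
  have hnorm : ‖τ • N‖ = τ := by rw [norm_smul, hN1, mul_one, Real.norm_of_nonneg hτ0.le]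
  have hsub : closedBall (y + τ • N) δ ⊆ closedBall y (2 * δ) := by
    refine closedBall_subset_closedBall' ?_
    rw [dist_eq_norm, add_sub_cancel_left, hnorm]
    linarith
  refine ⟨y + τ • N, ?_, hsub, ?_⟩
  · rw [mem_ball, dist_comm, dist_eq_norm, add_sub_cancel_left, hnorm]
    linarith
  · intro z hz
    refine lt_of_lt_of_le ?_ (hF z (hsub hz))
    rw [mem_closedBall, dist_eq_norm] at hz
    set w := z - y with hw
    have e1 : z - (y + τ • N) = w - τ • N := by rw [hw]; abel
    rw [e1] at hz
    have h1 : ‖w - τ • N‖ ^ 2 ≤ δ ^ 2 := by gcongr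
    rw [norm_sub_sq_real, hnorm, inner_smul_right, real_inner_comm] at h1
    have h2 : inner ℝ G w = ‖G‖ * inner ℝ N w := by
      conv_lhs => rw [hGN]
      rw [real_inner_smul_left]
    rw [h2]
    set i := inner ℝ N w with hi
    have h3 : ‖w‖ ^ 2 - σ * (δ + τ) ≤ 2 * τ * i := by nlinarith
    have h4 : 2 * τ * K * ‖w‖ ^ 2 ≤ ‖G‖ * ‖w‖ ^ 2 := by
      gcongr
      have : τ * K ≤ δ * K := by gcongr; linarith
      linarith
    have h5 : ‖G‖ * (σ * (δ + τ)) ≤ F y / 4 * (δ + τ) := by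
      rw [← mul_assoc]; gcongr
    have h6 : ‖G‖ * (‖w‖ ^ 2 - σ * (δ + τ)) ≤ ‖G‖ * (2 * τ * i) := by gcongr
    have h7 : F y / 4 * (δ + τ) < 2 * τ * F y := by
      have : δ ≤ 2 * τ := by linarith
      nlinarith
    have h8 : 0 < 2 * τ * (F y + ‖G‖ * i - K * ‖w‖ ^ 2) := by nlinarith
    exact pos_of_mul_pos_right h8 (by positivity)

/-- Second order Taylor bound near a point for a `C²` function. -/
theorem exists_taylor_bound {n : ℕ} {F : Rn n → ℝ} (hF : ContDiff ℝ 2 F) (x₀ : Rn n) :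
    ∃ (K : ℝ) (r : ℝ), 0 ≤ K ∧ 0 < r ∧ ∀ y ∈ ball x₀ r, ∀ z ∈ ball x₀ r,
      F y + fderiv ℝ F y (z - y) - K * ‖z - y‖ ^ 2 ≤ F z := by
  have h1 : ContDiff ℝ 1 (fderiv ℝ F) := hF.fderiv_right (by norm_num)
  obtain ⟨K, t, ht, hK⟩ := h1.contDiffAt.exists_lipschitzOnWith (x := x₀)
  obtain ⟨r, hr, hrt⟩ := Metric.mem_nhds_iff.1 ht
  refine ⟨K, r, K.2, hr, fun y hy z hz => ?_⟩
  have hseg : segment ℝ y z ⊆ ball x₀ r := (convex_ball x₀ r).segment_subset hy hz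
  have hdiff : Differentiable ℝ F := hF.differentiable (by norm_num)
  have h := Convex.norm_image_sub_le_of_norm_hasFDerivWithin_le' (f := F) (f' := fderiv ℝ F)
    (φ := fderiv ℝ F y) (C := K * ‖z - y‖) (s := segment ℝ y z)
    (fun w _ => (hdiff w).hasFDerivAt.hasFDerivWithinAt)
    (fun w hw => by
      refine (hK.norm_sub_le (hrt (hseg hw)) (hrt hy)).trans ?_
      gcongr
      exact norm_sub_le_of_mem_segment hw)
    (convex_segment y z) (left_mem_segment ℝ y z) (right_mem_segment ℝ y z)
  rw [Real.norm_eq_abs] at h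
  have h2 := (abs_le.1 h).1
  nlinarith

/-- The local statement at boundary points: `exists_closedBall_pos` for the defining function of a
chart, whose gradient has norm at least `1` because its derivative along `ν` is `-1`. -/
theorem exists_closedBall_near_frontier {n : ℕ} {Ω : Set (Rn n)} {x₀ : Rn n} {r : ℝ} {ν : Rn n}
    {g : Rn n → ℝ} (hr : 0 < r) (hν : ‖ν‖ = 1) (hg : ContDiff ℝ 2 g)
    (hΩ : ∀ y ∈ ball x₀ r, (y ∈ Ω ↔ inner ℝ ν y < g (y - inner ℝ ν y • ν))) :
    ∃ r₁ > 0, ∃ δ₁ > 0, ∀ δ, 0 < δ → δ < δ₁ → ∀ y ∈ ball x₀ r₁, y ∈ Ω →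
      ∃ x ∈ innerParallelSet δ Ω, y ∈ ball x δ := by
  set F : Rn n → ℝ := fun y => g (y - inner ℝ ν y • ν) - inner ℝ ν y with hFdef
  have hF : ContDiff ℝ 2 F := by
    have h1 : ContDiff ℝ 2 fun y : Rn n => inner ℝ ν y := contDiff_const.inner ℝ contDiff_id
    exact (hg.comp (contDiff_id.sub (h1.smul contDiff_const))).sub h1
  obtain ⟨K, r₂, hK, hr₂, htaylor⟩ := exists_taylor_bound hF x₀
  set r₃ := min r r₂ with hr₃
  have hr₃0 : 0 < r₃ := lt_min hr hr₂
  refine ⟨r₃ / 2, by positivity, min (r₃ / 4) (1 / (2 * (K + 1))), by positivity, ?_⟩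
  intro δ hδ hδ1 y hy hyΩ
  have hδa : δ < r₃ / 4 := hδ1.trans_le (min_le_left _ _)
  have hδb : 2 * K * δ ≤ 1 := by
    have h := hδ1.trans_le (min_le_right _ _)
    rw [lt_div_iff₀ (by positivity)] at h
    linarith
  have hsub : closedBall y (2 * δ) ⊆ ball x₀ r₃ := by
    refine closedBall_subset_ball' ?_
    rw [mem_ball] at hy
    linarith
  have hyr : y ∈ ball x₀ r₃ := hsub (mem_closedBall_self (by positivity))
  have hyF : 0 < F y := by
    have := (hΩ y (ball_subset_ball (min_le_left _ _) hyr)).1 hyΩ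
    simp only [hFdef]
    linarith
  set L := fderiv ℝ F y with hL
  have hLν : L ν = -1 := by
    have h1 : HasFDerivAt F L y := (hF.differentiable (by norm_num) y).hasFDerivAt
    have h2 : HasDerivAt (fun t : ℝ => F (y + t • ν)) (L ν) 0 := h1.hasLineDerivAt ν
    have h3 : (fun t : ℝ => F (y + t • ν)) = fun t => F y - t := by
      funext t
      exact chart_add_smul hν g y t
    rw [h3] at h2
    exact h2.unique ((hasDerivAt_id (0 : ℝ)).const_sub (F y))
  set G : Rn n := (InnerProductSpace.toDual ℝ (Rn n)).symm L with hG
  have hGL : ∀ v, inner ℝ G v = L v := fun v => InnerProductSpace.toDual_symm_apply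
  have hG1 : 1 ≤ ‖G‖ := by
    have h := abs_real_inner_le_norm G ν
    rw [hGL, hLν, hν] at h
    simpa using h
  obtain ⟨x, hx1, hx2, hx3⟩ := exists_closedBall_pos (F := F) (K := K) hyF hG1 hδ hK hδb
    (fun z hz => by
      rw [hGL]
      exact htaylor y (ball_subset_ball (min_le_right _ _) hyr) z
        (ball_subset_ball (min_le_right _ _) (hsub hz)))
  refine ⟨x, fun z hz => ?_, hx1⟩
  rw [hΩ z (ball_subset_ball (min_le_left _ _) (hsub (hx2 hz)))]
  have := hx3 z hz
  simp only [hFdef] at this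
  linarith

/-- A consequence of the interior ball condition: the balls of a small fixed radius contained in `Ω`
cover `Ω`. -/
theorem exists_innerParallelSet_cover {n : ℕ} {Ω : Set (Rn n)} (hΩo : IsOpen Ω)
    (hΩb : Bornology.IsBounded Ω) (hΩ : HasC2Boundary Ω) :
    ∃ δ₁ > 0, ∀ δ, 0 < δ → δ < δ₁ → ∀ y ∈ Ω, ∃ x ∈ innerParallelSet δ Ω, y ∈ ball x δ := by
  have key : ∃ δ₁ > 0, ∀ δ, 0 < δ → δ < δ₁ → ∀ y ∈ closure Ω, y ∈ Ω →
      ∃ x ∈ innerParallelSet δ Ω, y ∈ ball x δ := by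
    refine hΩb.isCompact_closure.induction_on
      (p := fun S => ∃ δ₁ > 0, ∀ δ, 0 < δ → δ < δ₁ → ∀ y ∈ S, y ∈ Ω →
        ∃ x ∈ innerParallelSet δ Ω, y ∈ ball x δ) ?_ ?_ ?_ ?_
    · exact ⟨1, one_pos, by simp⟩
    · rintro S T hST ⟨δ₁, h1, h2⟩
      exact ⟨δ₁, h1, fun δ hδ hδ' y hy => h2 δ hδ hδ' y (hST hy)⟩
    · rintro S T ⟨δ₁, h1, h2⟩ ⟨δ₂, h3, h4⟩
      refine ⟨min δ₁ δ₂, lt_min h1 h3, fun δ hδ hδ' y hy => ?_⟩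
      rcases hy with hy | hy
      · exact h2 δ hδ (hδ'.trans_le (min_le_left _ _)) y hy
      · exact h4 δ hδ (hδ'.trans_le (min_le_right _ _)) y hy
    · intro x₀ hx₀
      by_cases hx : x₀ ∈ Ω
      · obtain ⟨ε, hε, hsub⟩ := Metric.isOpen_iff.1 hΩo x₀ hx
        refine ⟨ball x₀ (ε / 2), mem_nhdsWithin_of_mem_nhds (ball_mem_nhds _ (by positivity)),
          ε / 2, by positivity, fun δ hδ hδ' y hy _ => ⟨y, ?_, mem_ball_self hδ⟩⟩
        refine (closedBall_subset_ball' ?_).trans hsub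
        rw [mem_ball] at hy
        linarith
      · obtain ⟨r, ν, g, hr, hν, hg, hgr⟩ := hΩ x₀ ⟨hx₀, by rwa [hΩo.interior_eq]⟩
        obtain ⟨r₁, hr₁, δ₁, hδ₁, h⟩ := exists_closedBall_near_frontier hr hν hg hgr
        exact ⟨ball x₀ r₁, mem_nhdsWithin_of_mem_nhds (ball_mem_nhds _ hr₁), δ₁, hδ₁, h⟩
  obtain ⟨δ₁, h1, h2⟩ := key
  exact ⟨δ₁, h1, fun δ hδ hδ' y hy => h2 δ hδ hδ' y (subset_closure hy) hy⟩

/-- The local statement at interior points: a path in `Ω` has positive distance from the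
complement. -/
theorem exists_joinedIn_near {n : ℕ} {Ω : Set (Rn n)} (hΩo : IsOpen Ω) (hΩ : IsConnected Ω)
    {z₀ x : Rn n} (hz₀ : z₀ ∈ Ω) (hx : x ∈ Ω) :
    ∃ r > 0, ∃ δ₁ > 0, ∀ δ, 0 < δ → δ < δ₁ → ∀ y ∈ ball x r,
      JoinedIn (innerParallelSet δ Ω) z₀ y := by
  obtain ⟨ε, hε, hsub⟩ := Metric.isOpen_iff.1 hΩo x hx
  have hpc : IsPathConnected Ω := hΩo.isConnected_iff_isPathConnected.1 hΩ
  obtain ⟨γ, hγ⟩ := hpc.joinedIn z₀ hz₀ x hx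
  set K : Set (Rn n) := range γ ∪ closedBall x (ε / 2) with hK
  have hKc : IsCompact K := (isCompact_range γ.continuous).union (isCompact_closedBall _ _)
  have hKΩ : K ⊆ Ω := by
    refine union_subset (range_subset_iff.2 hγ) ((closedBall_subset_ball ?_).trans hsub)
    linarith
  obtain ⟨δ₁, hδ₁, hthick⟩ := hKc.exists_cthickening_subset_open hΩo hKΩ
  refine ⟨ε / 2, by positivity, δ₁, hδ₁, fun δ hδ hδ' y hy => ?_⟩
  have hKD : K ⊆ innerParallelSet δ Ω := fun w hw =>
    ((closedBall_subset_cthickening hw δ).trans (cthickening_mono hδ'.le K)).trans hthick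
  have h1 : JoinedIn (innerParallelSet δ Ω) z₀ x :=
    ⟨γ, fun t => hKD (Or.inl (mem_range_self t))⟩
  refine h1.trans (JoinedIn.of_segment_subset ?_)
  refine (((convex_closedBall x (ε / 2)).segment_subset (mem_closedBall_self (by positivity))
    (ball_subset_closedBall hy)).trans subset_union_right).trans hKD

/-- Near a boundary point `Ω` is invariant under translations by `-t ν`, `t ≥ 0`, so that balls in
`Ω` can be moved inwards without leaving `Ω`. -/
theorem segment_subset_innerParallelSet {n : ℕ} {Ω : Set (Rn n)} {x₀ : Rn n} {r : ℝ} {ν : Rn n}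
    {g : Rn n → ℝ} (hν : ‖ν‖ = 1)
    (hΩ : ∀ y ∈ ball x₀ r, (y ∈ Ω ↔ inner ℝ ν y < g (y - inner ℝ ν y • ν)))
    {δ t : ℝ} {y : Rn n} (ht : 0 ≤ t) (hy : y ∈ innerParallelSet δ Ω)
    (hr : dist y x₀ + δ + t < r) :
    segment ℝ y (y + (-t) • ν) ⊆ innerParallelSet δ Ω := by
  rw [segment_eq_image']
  rintro _ ⟨θ, ⟨hθ0, hθ1⟩, rfl⟩ z hz
  have hθt : θ * t ≤ t := mul_le_of_le_one_left ht hθ1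
  have hθt0 : 0 ≤ θ * t := by positivity
  have e : y + θ • (y + (-t) • ν - y) = y + (-(θ * t)) • ν := by
    rw [add_sub_cancel_left, smul_smul]
    congr 2
    ring
  simp only [e] at hz
  have hdist : dist (y + (-(θ * t)) • ν) y ≤ t := by
    rw [dist_eq_norm, add_sub_cancel_left, norm_smul, hν, mul_one, norm_neg,
      Real.norm_of_nonneg hθt0]
    exact hθt
  have hz' : z + (θ * t) • ν ∈ closedBall y δ := by
    rw [mem_closedBall, dist_eq_norm] at hz ⊢
    have : z + (θ * t) • ν - y = z - (y + (-(θ * t)) • ν) := by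
      rw [neg_smul]; abel
    rwa [this]
  have hb : z + (θ * t) • ν ∈ ball x₀ r := by
    refine closedBall_subset_ball' ?_ hz'
    linarith
  have hb2 : z ∈ ball x₀ r := by
    refine closedBall_subset_ball' ?_ hz
    linarith [dist_triangle (y + (-(θ * t)) • ν) y x₀]
  have h1 := (hΩ _ hb).1 (hy hz')
  rw [hΩ z hb2]
  have h2 := chart_add_smul hν g z (θ * t)
  linarith

/-- The set of centres of balls of radius `δ` in `Ω` is path connected for small `δ`. -/
theorem exists_joinedIn_innerParallelSet {n : ℕ} {Ω : Set (Rn n)} (hΩo : IsOpen Ω)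
    (hΩb : Bornology.IsBounded Ω) (hΩc : IsConnected Ω) (hΩ : HasC2Boundary Ω) {z₀ : Rn n}
    (hz₀ : z₀ ∈ Ω) :
    ∃ δ₁ > 0, ∀ δ, 0 < δ → δ < δ₁ → ∀ y ∈ innerParallelSet δ Ω,
      JoinedIn (innerParallelSet δ Ω) z₀ y := by
  have key : ∃ δ₁ > 0, ∀ δ, 0 < δ → δ < δ₁ → ∀ y ∈ closure Ω, y ∈ innerParallelSet δ Ω →
      JoinedIn (innerParallelSet δ Ω) z₀ y := by
    refine hΩb.isCompact_closure.induction_on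
      (p := fun S => ∃ δ₁ > 0, ∀ δ, 0 < δ → δ < δ₁ → ∀ y ∈ S, y ∈ innerParallelSet δ Ω →
        JoinedIn (innerParallelSet δ Ω) z₀ y) ?_ ?_ ?_ ?_
    · exact ⟨1, one_pos, by simp⟩
    · rintro S T hST ⟨δ₁, h1, h2⟩
      exact ⟨δ₁, h1, fun δ hδ hδ' y hy => h2 δ hδ hδ' y (hST hy)⟩
    · rintro S T ⟨δ₁, h1, h2⟩ ⟨δ₂, h3, h4⟩
      refine ⟨min δ₁ δ₂, lt_min h1 h3, fun δ hδ hδ' y hy => ?_⟩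
      rcases hy with hy | hy
      · exact h2 δ hδ (hδ'.trans_le (min_le_left _ _)) y hy
      · exact h4 δ hδ (hδ'.trans_le (min_le_right _ _)) y hy
    · intro x₀ hx₀
      by_cases hx : x₀ ∈ Ω
      · obtain ⟨r, hr, δ₁, hδ₁, h⟩ := exists_joinedIn_near hΩo hΩc hz₀ hx
        exact ⟨ball x₀ r, mem_nhdsWithin_of_mem_nhds (ball_mem_nhds _ hr), δ₁, hδ₁,
          fun δ hδ hδ' y hy _ => h δ hδ hδ' y hy⟩
      · obtain ⟨r, ν, g, hr, hν, hg, hgr⟩ := hΩ x₀ ⟨hx₀, by rwa [hΩo.interior_eq]⟩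
        -- a neighbourhood of `x₀` is moved along `-ν` into one of a point of `Ω`
        have hw : x₀ + (-(r / 4)) • ν ∈ Ω := by
          have hb : x₀ + (-(r / 4)) • ν ∈ ball x₀ r := by
            rw [mem_ball, dist_eq_norm, add_sub_cancel_left, norm_smul, hν, mul_one, norm_neg,
              Real.norm_of_nonneg (by positivity)]
            linarith
          rw [hgr _ hb]
          have h2 := chart_add_smul hν g x₀ (-(r / 4))
          have h3 : 0 ≤ g (x₀ - inner ℝ ν x₀ • ν) - inner ℝ ν x₀ := by
            by_contra hneg
            push Not at hneg
            have hgc : Continuous g := hg.continuous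
            have hopen : IsOpen {y : Rn n | g (y - inner ℝ ν y • ν) - inner ℝ ν y < 0} :=
              isOpen_lt (by fun_prop) continuous_const
            obtain ⟨z, ⟨hz1, hz2⟩, hz3⟩ := mem_closure_iff.1 hx₀ _
              (hopen.inter (isOpen_ball (x := x₀) (ε := r))) ⟨hneg, mem_ball_self hr⟩
            have h4 := (hgr z hz2).1 hz3
            have h5 : g (z - inner ℝ ν z • ν) - inner ℝ ν z < 0 := hz1
            linarith
          linarith
        obtain ⟨r₁, hr₁, δ₁, hδ₁, h⟩ := exists_joinedIn_near hΩo hΩc hz₀ hw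
        refine ⟨ball x₀ (min r₁ (r / 4)),
          mem_nhdsWithin_of_mem_nhds (ball_mem_nhds _ (by positivity)), min δ₁ (r / 4),
          by positivity, fun δ hδ hδ' y hy hyD => ?_⟩
        have hy1 : dist y x₀ < r₁ := lt_of_lt_of_le hy (min_le_left _ _)
        have hy2 : dist y x₀ < r / 4 := lt_of_lt_of_le hy (min_le_right _ _)
        have hδ2 : δ < r / 4 := hδ'.trans_le (min_le_right _ _)
        have h1 := h δ hδ (hδ'.trans_le (min_le_left _ _)) (y + (-(r / 4)) • ν) (by
          rw [mem_ball, dist_add_right]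
          exact hy1)
        refine h1.trans (JoinedIn.of_segment_subset ?_).symm
        exact segment_subset_innerParallelSet hν hgr (by positivity) hyD (by linarith)
  obtain ⟨δ₁, h1, h2⟩ := key
  exact ⟨δ₁, h1, fun δ hδ hδ' y hy =>
    h2 δ hδ hδ' y (subset_closure (hy (mem_closedBall_self hδ.le))) hy⟩

/-! ### The dichotomy and the choice of sequences -/

theorem exists_larger_ball_subset {n : ℕ} {Ω : Set (Rn n)} (hΩo : IsOpen Ω) {δ : ℝ} (hδ : 0 ≤ δ)
    {x : Rn n} (hx : x ∈ innerParallelSet δ Ω) : ∃ ε > 0, ball x (δ + ε) ⊆ Ω := by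
  obtain ⟨ε, hε, hsub⟩ := (isCompact_closedBall x δ).exists_thickening_subset_open hΩo hx
  refine ⟨ε, hε, ?_⟩
  rwa [thickening_closedBall hε hδ, add_comm] at hsub

/-- If null balls of radius `δ` can be enlarged within `Ω`, then being null is a locally constant
property of the balls of radius `δ` in `Ω`, hence constant along paths of centres. -/
theorem null_ball_of_joinedIn {n : ℕ} {Ω E : Set (Rn n)} (hΩo : IsOpen Ω) {δ : ℝ} (hδ : 0 < δ)
    (hE : ∀ (x : Rn n) (ρ : ℝ), ball x ρ ⊆ Ω → volume (E ∩ ball x δ) = 0 →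
      volume (E ∩ ball x ρ) = 0) {x y : Rn n} (hxy : JoinedIn (innerParallelSet δ Ω) x y)
    (hx : volume (E ∩ ball x δ) = 0) : volume (E ∩ ball y δ) = 0 := by
  have hloc : ∀ w ∈ innerParallelSet δ Ω, ∀ᶠ w' in 𝓝 w,
      (volume (E ∩ ball w' δ) = 0 ↔ volume (E ∩ ball w δ) = 0) := by
    intro w hw
    obtain ⟨ε, hε, hsub⟩ := exists_larger_ball_subset hΩo hδ.le hw
    filter_upwards [ball_mem_nhds w (by positivity : 0 < ε / 2)] with w' hw'
    rw [mem_ball] at hw'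
    constructor
    · intro h
      have h1 := hE w' (δ + ε / 2) ((ball_subset_ball' (by linarith)).trans hsub) h
      refine measure_mono_null (inter_subset_inter_right _ (ball_subset_ball' ?_)) h1
      rw [dist_comm]
      linarith
    · intro h
      have h1 := hE w (δ + ε) hsub h
      exact measure_mono_null (inter_subset_inter_right _ (ball_subset_ball' (by linarith))) h1
  obtain ⟨γ, hγ⟩ := hxy
  have hconst : IsLocallyConstant fun t => volume (E ∩ ball (γ t) δ) = 0 := by
    rw [IsLocallyConstant.iff_eventually_eq]
    intro t
    filter_upwards [γ.continuous.continuousAt.eventually (hloc (γ t) (hγ t))] with t' ht'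
    exact propext ht'
  have h := hconst.apply_eq_of_preconnectedSpace 0 1
  simp only [γ.source, γ.target] at h
  exact h ▸ hx

/-- The dichotomy: for small `s` a minimal set avoids `Ω` or is `δ_s`-dense in `Ω`. -/
theorem eventually_empty_or_dense {n : ℕ} (hn : 1 ≤ n) {Ω E₀ : Set (Rn n)} (hΩo : IsOpen Ω)
    (hΩb : Bornology.IsBounded Ω) (hΩc : IsConnected Ω) (hΩ : HasC2Boundary Ω)
    (hβ : 0 < betaOf E₀) :
    ∀ᶠ s : ℝ in 𝓝[>] 0, ∀ E, IsSMinimal s Ω E₀ E →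
      E ∩ Ω = ∅ ∨ IsDeltaDense (deltaOf E₀ s) E Ω := by
  obtain ⟨z₀, hz₀⟩ := hΩc.nonempty
  obtain ⟨δ₁, hδ₁, hcover⟩ := exists_innerParallelSet_cover hΩo hΩb hΩ
  obtain ⟨δ₂, hδ₂, hjoin⟩ := exists_joinedIn_innerParallelSet hΩo hΩb hΩc hΩ hz₀
  filter_upwards [eventually_null_ball_enlarges hn hΩo.measurableSet hΩb hβ,
    (tendsto_deltaOf hn hβ).eventually_lt_const hδ₁,
    (tendsto_deltaOf hn hβ).eventually_lt_const hδ₂] with s hs hs1 hs2 E hE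
  have hδ := deltaOf_pos E₀ s
  refine or_iff_not_imp_right.2 fun hdense => ?_
  unfold IsDeltaDense at hdense
  push Not at hdense
  obtain ⟨x, hx, hxD, hx0⟩ := hdense
  rw [inter_comm] at hx0
  have hx0' : volume (E ∩ ball x (deltaOf E₀ s)) = 0 := le_antisymm hx0 bot_le
  rw [eq_empty_iff_forall_notMem]
  rintro p ⟨hpE, hpΩ⟩
  obtain ⟨y, hyD, hpy⟩ := hcover _ hδ hs1 p hpΩ
  have hy0 := null_ball_of_joinedIn hΩo hδ (hs E hE)
    ((hjoin _ hδ hs2 x hxD).symm.trans (hjoin _ hδ hs2 y hyD)) hx0'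
  obtain ⟨r, hr, hsub⟩ := Metric.isOpen_iff.1 isOpen_ball p hpy
  exact hE.normalized.exterior_subset p hpΩ
    ⟨r, hr, measure_mono_null (inter_subset_inter_right _ hsub) hy0⟩ hpE

theorem IsDeltaDense.mono {n : ℕ} {δ δ' : ℝ} {E Ω : Set (Rn n)} (h : IsDeltaDense δ E Ω)
    (hδ : δ ≤ δ') : IsDeltaDense δ' E Ω := fun x hx hsub =>
  (h x hx ((closedBall_subset_closedBall hδ).trans hsub)).trans_le
    (measure_mono (inter_subset_inter_left _ (ball_subset_ball hδ)))

theorem frontier_inter_ball_nonempty {n : ℕ} {E : Set (Rn n)} {x : Rn n} {δ : ℝ}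
    (h1 : 0 < volume (ball x δ ∩ E)) (h2 : volume (ball x δ \ E) ≠ 0) :
    (frontier E ∩ ball x δ).Nonempty := by
  by_contra hempty
  have hcov : ball x δ ⊆ interior E ∪ (closure E)ᶜ := by
    intro y hy
    by_contra hy'
    rw [mem_union, mem_compl_iff, not_or, not_not] at hy'
    exact hempty ⟨y, ⟨hy'.2, hy'.1⟩, hy⟩
  obtain ⟨y, hy1, hy2⟩ := nonempty_of_measure_ne_zero h1.ne'
  obtain ⟨z, hz1, hz2⟩ := nonempty_of_measure_ne_zero h2
  obtain ⟨w, -, hw1, hw2⟩ := (convex_ball x δ).isPreconnected _ _ isOpen_interior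
    isClosed_closure.isOpen_compl hcov
    ⟨y, hy1, (hcov hy1).resolve_right fun h => h (subset_closure hy2)⟩
    ⟨z, hz1, (hcov hz1).resolve_left fun h => hz2 (interior_subset h)⟩
  exact hw2 (subset_closure (interior_subset hw1))

/-- A diagonal choice: properties that hold for arbitrarily small `s > 0` hold along a decreasing
null sequence. -/
theorem exists_strictAnti_seq {P : ℕ → ℝ → Prop} (h : ∀ k, ∃ᶠ s in 𝓝[>] (0 : ℝ), P k s) :
    ∃ s : ℕ → ℝ, (∀ k, 0 < s k ∧ s k < 1) ∧ StrictAnti s ∧ Tendsto s atTop (𝓝 0) ∧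
      ∀ k, P k (s k) := by
  -- the positivity of `ε` is part of the conclusion, so that the choice can be iterated
  have hex : ∀ (k : ℕ) (ε : ℝ), ∃ s, 0 < ε → 0 < s ∧ s < ε ∧ P k s := by
    intro k ε
    by_cases hε : 0 < ε
    · have h1 : ∀ᶠ s in 𝓝[>] (0 : ℝ), s ∈ Ioo 0 ε := Ioo_mem_nhdsGT hε
      obtain ⟨s, hs1, hs2⟩ := ((h k).and_eventually h1).exists
      exact ⟨s, fun _ => ⟨hs2.1, hs2.2, hs1⟩⟩
    · exact ⟨0, fun h => absurd h hε⟩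
  choose f hf using hex
  let s : ℕ → ℝ := fun k =>
    Nat.rec (f 0 1) (fun k t => f (k + 1) (min t (1 / ((k : ℝ) + 2)))) k
  have hs0 : s 0 = f 0 1 := rfl
  have hsucc : ∀ k, s (k + 1) = f (k + 1) (min (s k) (1 / ((k : ℝ) + 2))) := fun k => rfl
  have hpos : ∀ k, 0 < s k := by
    intro k
    induction k with
    | zero => exact (hf 0 1 one_pos).1
    | succ k ih => exact (hf (k + 1) _ (lt_min ih (by positivity))).1
  have hmin : ∀ k, s (k + 1) < min (s k) (1 / ((k : ℝ) + 2)) := fun k =>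
    (hf (k + 1) _ (lt_min (hpos k) (by positivity))).2.1
  have hbd : ∀ k, s k < 1 / ((k : ℝ) + 1) := by
    intro k
    cases k with
    | zero =>
      rw [hs0, Nat.cast_zero, zero_add, div_one]
      exact (hf 0 1 one_pos).2.1
    | succ k =>
      refine (hmin k).trans_le ((min_le_right _ _).trans (le_of_eq ?_))
      push_cast
      ring
  have hanti : StrictAnti s := strictAnti_nat_of_succ_lt fun k =>
    (hmin k).trans_le (min_le_left _ _)
  refine ⟨s, fun k => ⟨hpos k, ?_⟩, hanti, ?_, ?_⟩
  · exact (hanti.antitone (Nat.zero_le k)).trans_lt (hf 0 1 one_pos).2.1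
  · exact squeeze_zero (fun k => (hpos k).le) (fun k => (hbd k).le)
      tendsto_one_div_add_atTop_nhds_zero_nat
  · intro k
    cases k with
    | zero => exact (hf 0 1 one_pos).2.2
    | succ k => exact (hf (k + 1) _ (lt_min (hpos k) (by positivity))).2.2

theorem theorem1p3 (n : ℕ) (hn : 1 ≤ n) (Ω : Set (Rn n)) (hΩ_open : IsOpen Ω)
    (hΩ_bdd : Bornology.IsBounded Ω) (hΩ_conn : IsConnected Ω) (hΩ_C2 : HasC2Boundary Ω)
    (E₀ : Set (Rn n)) (hE₀_meas : NullMeasurableSet E₀ volume) (hE₀ : E₀ ⊆ Ωᶜ)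
    (hα : alphaSup E₀ < sphereArea n / 2) :
    (∀ s₀ : ℝ, 0 < s₀ → s₀ ≤ 1 / 2 →
      ∃ s₁ : ℝ, 0 < s₁ ∧ s₁ ≤ s₀ ∧
        ∀ s : ℝ, 0 < s → s < s₁ → ∀ E : Set (Rn n), IsSMinimal s Ω E₀ E →
          E ∩ Ω = ∅ ∨ IsDeltaDense (deltaOf E₀ s) E Ω) ∧
    ((∃ s' : ℝ, 0 < s' ∧ s' < 1 ∧
        ∀ s : ℝ, 0 < s → s < s' → ∀ E : Set (Rn n), IsSMinimal s Ω E₀ E → E ∩ Ω = ∅) ∨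
      (∃ (δ s : ℕ → ℝ) (E : ℕ → Set (Rn n)),
        (∀ k, 0 < δ k) ∧ StrictAnti δ ∧ Tendsto δ atTop (𝓝 0) ∧
        (∀ k, 0 < s k ∧ s k < 1) ∧ StrictAnti s ∧ Tendsto s atTop (𝓝 0) ∧
        ∀ k, IsSMinimal (s k) Ω E₀ (E k) ∧
          ∀ x : Rn n, closedBall x (δ k) ⊆ Ω →
            (frontier (E k) ∩ ball x (δ k)).Nonempty)) := by
  have hβ : 0 < betaOf E₀ := by
    unfold betaOf
    linarith
  have hdich := eventually_empty_or_dense hn hΩ_open hΩ_bdd hΩ_conn hΩ_C2 hβ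
  have hnear : ∀ {p : ℝ → Prop}, (∀ᶠ s in 𝓝[>] (0 : ℝ), p s) → ∀ s₀ > 0,
      ∃ s₁, 0 < s₁ ∧ s₁ ≤ s₀ ∧ ∀ s, 0 < s → s < s₁ → p s := by
    intro p hp s₀ hs₀
    obtain ⟨u, hu, hsub⟩ := mem_nhdsGT_iff_exists_Ioo_subset.1 hp
    exact ⟨min u s₀, lt_min hu hs₀, min_le_right _ _, fun s h1 h2 =>
      hsub ⟨h1, h2.trans_le (min_le_left _ _)⟩⟩
  refine ⟨fun s₀ hs₀ _ => hnear hdich s₀ hs₀, ?_⟩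
  by_cases hB : ∀ᶠ s in 𝓝[>] (0 : ℝ), ∀ E : Set (Rn n), IsSMinimal s Ω E₀ E → E ∩ Ω = ∅
  · obtain ⟨s', h1, h2, h3⟩ := hnear hB (1 / 2) (by norm_num)
    exact Or.inl ⟨s', h1, by linarith, h3⟩
  · right
    have hfreq : ∃ᶠ s in 𝓝[>] (0 : ℝ), ∃ E : Set (Rn n), IsSMinimal s Ω E₀ E ∧ E ∩ Ω ≠ ∅ := by
      rw [not_eventually] at hB
      refine hB.mono fun s hs => ?_
      push Not at hs
      obtain ⟨E, hE1, hE2⟩ := hs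
      exact ⟨E, hE1, hE2.ne_empty⟩
    set δ : ℕ → ℝ := fun k => 1 / ((k : ℝ) + 1) with hδ
    have hδpos : ∀ k, 0 < δ k := fun k => by positivity
    have hP : ∀ k, ∃ᶠ s in 𝓝[>] (0 : ℝ), ∃ E : Set (Rn n), IsSMinimal s Ω E₀ E ∧
        ∀ x : Rn n, closedBall x (δ k) ⊆ Ω → (frontier E ∩ ball x (δ k)).Nonempty := by
      intro k
      refine (hfreq.and_eventually (hdich.and ((eventually_ball_not_ae_subset hn
        hΩ_open.measurableSet hΩ_bdd hβ (hδpos k)).and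
        ((tendsto_deltaOf hn hβ).eventually_lt_const (hδpos k))))).mono ?_
      rintro s ⟨⟨E, hE, hne⟩, hd, hfull, hlt⟩
      refine ⟨E, hE, fun x hx => frontier_inter_ball_nonempty ?_
        (hfull E hE x (ball_subset_closedBall.trans hx))⟩
      exact ((hd E hE).resolve_left hne).mono hlt.le x
        (hx (mem_closedBall_self (hδpos k).le)) hx
    obtain ⟨s, hs1, hs2, hs3, hs4⟩ := exists_strictAnti_seq hP
    choose E hE using hs4
    refine ⟨δ, s, E, hδpos, ?_, tendsto_one_div_add_atTop_nhds_zero_nat, hs1, hs2, hs3, hE⟩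
    refine strictAnti_nat_of_succ_lt fun k => ?_
    simp only [hδ]
    push_cast
    gcongr
    linarith
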